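/- **Theorem (upper bound).** Let $\lambda$ be the uniform probability measure on the unit sphere $\mathbb S^{d-1}\subset\mathbb R^d$ and let $\vartheta\in(0,1)$. For probability distributions $P_X,P_Y$ on $\mathbb R^d$ and $\beta\in\mathbb S^{d-1}$, let $F_{\beta^\top X},F_{\beta^\top Y}$ be the distribution functions of $\beta^\top X$, $\beta^\top Y$ for $X\sim P_X$, $Y\sim P_Y$, let $H_\beta=\vartheta F_{\beta^\top X}+(1-\vartheta)F_{\beta^\top Y}$, and define $W_d(P_X,P_Y)\ge 0$ by $$W_d^2(P_X,P_Y)=\int_{\mathbb S^{d-1}}\int_{\mathbb R}\bigl(F_{\beta^\top X}(t)-F_{\beta^\top Y}(t)\bigr)^2\,dH_\beta(t)\,d\lambda(\beta).$$ For $\epsilon>0$ let $\mathcal F_d(\epsilon)$ be the set of pairs $(P_X,P_Y)$ of probability distributions on $\mathbb R^d$ with $W_d(P_X,P_Y)\ge\epsilon$ such that $F_{\beta^\top X}$ and $F_{\beta^\top Y}$ are continuous for $\lambda$-almost every $\beta$. Let $m,n\ge 2$, $N=m+n$, and let $X_1,\dots,X_m\sim P_X$ and $Y_1,\dots,Y_n\sim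 P_Y$ be independent, with pooled sample $Z=(Z_1,\dots,Z_N)=(X_1,\dots,X_m,Y_1,\dots,Y_n)$. With $\mathsf{Ang}(u,v)=\arccos\{u^\top v/(\|u\|\,\|v\|)\}$, put $$h(x_1,x_2;y_1,y_2)=\tfrac13-\tfrac1{2\pi}\mathsf{Ang}(x_1-y_1,x_2-y_1)-\tfrac1{2\pi}\mathsf{Ang}(y_1-x_1,y_2-x_1),$$ $$U(Z)=\frac1{m(m-1)\,n(n-1)}\sum_{i_1\ne i_2}\ \sum_{j_1\ne j_2}h(X_{i_1},X_{i_2};Y_{j_1},Y_{j_2}).$$ For $\alpha\in(0,1)$ let $$c_\alpha(Z)=\inf\Bigl\{t\in\mathbb R:\ 1-\alpha\le\frac1{N!}\sum_{\varpi\in\mathcal S_N}\mathbf 1\bigl(U(Z_{\varpi(1)},\dots,Z_{\varpi(N)})\le t\bigr)\Bigr\}$$ be the permutation critical value, and let $\phi=\mathbf 1(U(Z)>c_\alpha(Z))$ be the permutation Cramér–von Mises test. Then for every $\alpha\in(0,1)$ and every $\zeta\in(0,1-\alpha)$ there is a constant $c_0>0$, depending only on $\alpha$ and $\zeta$, such that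 for all $c\ge c_0$, all $d\ge1$, all $m,n\ge2$ (with no restriction on the ratio $m/n$) and all $\vartheta\in(0,1)$, $$\sup_{(P_X,P_Y)\in\mathcal F_d(\epsilon^\star_{m,n})}\mathbb P(\phi=0)<\zeta,\qquad\text{where }\ \epsilon^\star_{m,n}=c\Bigl(\frac1{\sqrt m}+\frac1{\sqrt n}\Bigr).$$ (The supremum over the empty set is read as $0$.) -/

import Mathlib

noncomputable section

open MeasureTheory ProbabilityTheory

namespace CvM

/-- Euclidean space `ℝ^d`. -/
abbrev E (d : ℕ) : Type := EuclideanSpace ℝ (Fin d)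

/-- The uniform probability measure `λ` on the unit sphere of `ℝ^d`: the normalized surface measure
(for `d = 1`, mass `1/2` at each of `1` and `-1`). -/
def sphereUnif (d : ℕ) : Measure (Metric.sphere (0 : E d) 1) :=
  ((volume : Measure (E d)).toSphere Set.univ)⁻¹ • (volume : Measure (E d)).toSphere

/-- The law of the projection `β^⊤ X` for `X ∼ P`. -/
def projLaw {d : ℕ} (P : Measure (E d)) (β : Metric.sphere (0 : E d) 1) : Measure ℝ :=
  P.map (fun x => inner ℝ (β : E d) x)

/-- The distribution function `F_{β^⊤ X}` for `X ∼ P`. -/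
def projCDF {d : ℕ} (P : Measure (E d)) (β : Metric.sphere (0 : E d) 1) (t : ℝ) : ℝ :=
  cdf (projLaw P β) t

/-- The measure `dH_β` where `H_β = θ F_{β^⊤ X} + (1 - θ) F_{β^⊤ Y}`. -/
def mixLaw {d : ℕ} (θ : ℝ) (P Q : Measure (E d)) (β : Metric.sphere (0 : E d) 1) : Measure ℝ :=
  ENNReal.ofReal θ • projLaw P β + ENNReal.ofReal (1 - θ) • projLaw Q β

/-- The squared multivariate Cramér-von Mises distance `W_d^2(P, Q)` with weights `θ`, `1 - θ`. -/
def sqDist {d : ℕ} (θ : ℝ) (P Q : Measure (E d)) : ℝ :=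
  ∫ β, (∫ t, (projCDF P β t - projCDF Q β t) ^ 2 ∂(mixLaw θ P Q β)) ∂(sphereUnif d)

/-- The multivariate Cramér-von Mises distance `W_d(P, Q)`. -/
def dist {d : ℕ} (θ : ℝ) (P Q : Measure (E d)) : ℝ :=
  Real.sqrt (sqDist θ P Q)

/-- For almost every direction `β`, the projection of `P` has a continuous distribution function. -/
def ContinuousProjections {d : ℕ} (P : Measure (E d)) : Prop :=
  ∀ᵐ β ∂(sphereUnif d), Continuous (projCDF P β)

/-- The class `F(ε)` of pairs of distributions at Cramér-von Mises distance at least `ε`. -/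
def altClass (d : ℕ) (θ ε : ℝ) : Set (ProbabilityMeasure (E d) × ProbabilityMeasure (E d)) :=
  {p | ContinuousProjections (p.1 : Measure (E d)) ∧ ContinuousProjections (p.2 : Measure (E d)) ∧
    ε ≤ dist θ (p.1 : Measure (E d)) (p.2 : Measure (E d))}

/-- The kernel `h_CvM(x₁, x₂; y₁, y₂)`. -/
def kernel {d : ℕ} (x₁ x₂ y₁ y₂ : E d) : ℝ :=
  1 / 3 - 1 / (2 * Real.pi) * InnerProductGeometry.angle (x₁ - y₁) (x₂ - y₁)
    - 1 / (2 * Real.pi) * InnerProductGeometry.angle (y₁ - x₁) (y₂ - x₁)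

/-- The statistic `U_CvM` of a pooled sample `z`, whose first `m` points form the `X`-sample and
whose last `n` points form the `Y`-sample. The sums run over ordered pairs of distinct indices. -/
def uStat {d m n : ℕ} (z : Fin (m + n) → E d) : ℝ :=
  1 / (((m : ℝ) * (m - 1)) * ((n : ℝ) * (n - 1))) *
    ∑ i ∈ (Finset.univ : Finset (Fin m)).offDiag, ∑ j ∈ (Finset.univ : Finset (Fin n)).offDiag,
      kernel (z (Fin.castAdd n i.1)) (z (Fin.castAdd n i.2))
        (z (Fin.natAdd m j.1)) (z (Fin.natAdd m j.2))

/-- The permutation distribution function of `U_CvM` given the pooled sample `z`. -/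
def permCDF {d m n : ℕ} (z : Fin (m + n) → E d) (t : ℝ) : ℝ :=
  1 / ((m + n).factorial : ℝ) *
    ∑ ϖ : Equiv.Perm (Fin (m + n)), Set.indicator (Set.Iic t) (fun _ => (1 : ℝ)) (uStat (z ∘ ϖ))

/-- The level-`α` permutation critical value `c_{α,CvM}`. -/
def critValue {d m n : ℕ} (α : ℝ) (z : Fin (m + n) → E d) : ℝ :=
  sInf {t : ℝ | 1 - α ≤ permCDF z t}

open Classical in
/-- The permutation test `φ_CvM = 1(U_CvM > c_{α,CvM})`. -/
def test {d m n : ℕ} (α : ℝ) (z : Fin (m + n) → E d) : ℕ :=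
  if critValue α z < uStat z then 1 else 0

/-- The joint law of independent samples `X_1, …, X_m ∼ P` and `Y_1, …, Y_n ∼ Q`. -/
def sampleLaw {d : ℕ} (m n : ℕ) (P Q : ProbabilityMeasure (E d)) :
    Measure ((Fin m → E d) × (Fin n → E d)) :=
  (Measure.pi fun _ => (P : Measure (E d))).prod (Measure.pi fun _ => (Q : Measure (E d)))

/-- The type II error `ℙ₁(φ_CvM = 0)` when the samples come from `P` and `Q`. -/
def typeIIError {d : ℕ} (α : ℝ) (m n : ℕ) (P Q : ProbabilityMeasure (E d)) : ENNReal :=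
  sampleLaw m n P Q {s | test α (Fin.append s.1 s.2) = 0}

end CvM

end

noncomputable section

open MeasureTheory ProbabilityTheory
open scoped Pointwise

namespace CvM

/-! ### Planar rotations -/

section Rotation

variable {V : Type*} [NormedAddCommGroup V] [InnerProductSpace ℝ V]

/-! Write `r = 1/m + 1/n` and `W` for the squared distance `sqDist`. The proof shows that the type
II error is at most a constant times `r / W` once `W` exceeds a multiple of `r / α`. Under the
assumed separation `W` is at least `c² r`, so a large `c` suffices. The sample sizes enter only
through `r`, which is why their ratio is free.

The statistic is an average over directions. A uniform direction makes an obtuse angle with both `u`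
and `v` with probability `1/2 - Ang(u,v)/(2π)` (`sphereUnif_wedge`), so for distinct points `uStat`
is the spherical mean of the one-dimensional `projStat` (`uStat_eq_integral`). In one dimension,
counting order patterns of triples shows that `projStat + 2r` dominates the nonnegative `vStat`, the
squared distance between empirical distribution functions (`vStat_le_projStat`). Hence `uStat ≥ -2r`
for every arrangement of the pooled sample.

The critical value needs only a first moment. The angles of a triangle sum to `π`, so the permuted
statistics average to exactly zero (`sum_perm_uStat`). Together with the lower bound `-2r`, Markov's
inequality gives a critical value of at most `2r / α` (`critValue_le`). Non-rejection therefore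
forces the averaged `vStat` below `4r / α`.

Under the alternative, the averaged `vStat` is at least `T/2 - 2R`. Here `T` is a weighted empirical
mean with expectation `W` and variance at most `r W`, handled by Chebyshev. The term `R` collects
the estimation errors of the empirical distribution functions and has expectation at most `3r`,
handled by Markov (`typeIIError_le`). -/

/-- The rotation by the angle `s` in the plane spanned by the orthonormal vectors `e` and `f`. -/
def planeRotation (e f : V) (s : ℝ) (x : V) : V :=
  x + ((Real.cos s - 1) * inner ℝ e x - Real.sin s * inner ℝ f x) • e
    + (Real.sin s * inner ℝ e x + (Real.cos s - 1) * inner ℝ f x) • f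

theorem inner_left_planeRotation {e f : V} (he : ‖e‖ = 1) (hef : inner ℝ e f = 0)
    (s : ℝ) (x : V) :
    inner ℝ e (planeRotation e f s x) = Real.cos s * inner ℝ e x - Real.sin s * inner ℝ f x := by
  simp only [planeRotation, inner_add_right, inner_smul_right, hef, real_inner_self_eq_norm_sq, he]
  ring

theorem inner_right_planeRotation {e f : V} (hf : ‖f‖ = 1) (hef : inner ℝ e f = 0)
    (s : ℝ) (x : V) :
    inner ℝ f (planeRotation e f s x) = Real.sin s * inner ℝ e x + Real.cos s * inner ℝ f x := by
  have hfe : inner ℝ f e = 0 := by rw [real_inner_comm]; exact hef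
  simp only [planeRotation, inner_add_right, inner_smul_right, hfe, real_inner_self_eq_norm_sq, hf]
  ring

theorem norm_planeRotation {e f : V} (he : ‖e‖ = 1) (hf : ‖f‖ = 1) (hef : inner ℝ e f = 0)
    (s : ℝ) (x : V) : ‖planeRotation e f s x‖ = ‖x‖ := by
  have hfe : inner ℝ f e = 0 := by rw [real_inner_comm]; exact hef
  rw [← sq_eq_sq₀ (norm_nonneg _) (norm_nonneg _), ← real_inner_self_eq_norm_sq,
    ← real_inner_self_eq_norm_sq]
  simp only [planeRotation, inner_add_right, inner_smul_right, inner_add_left, inner_smul_left,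
    hfe, hef, real_inner_self_eq_norm_sq, he, hf, conj_trivial]
  rw [real_inner_comm e x, real_inner_comm f x]
  linear_combination ((inner ℝ e x) ^ 2 + (inner ℝ f x) ^ 2) * Real.sin_sq_add_cos_sq s

/-- `planeRotation` as a linear isometry. -/
def planeRotationIsometry {e f : V} (he : ‖e‖ = 1) (hf : ‖f‖ = 1) (hef : inner ℝ e f = 0)
    (s : ℝ) : V →ₗᵢ[ℝ] V where
  toFun := planeRotation e f s
  map_add' x y := by
    simp only [planeRotation, inner_add_right]
    module
  map_smul' c x := by
    simp only [planeRotation, inner_smul_right, RingHom.id_apply]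
    module
  norm_map' := norm_planeRotation he hf hef s

variable [FiniteDimensional ℝ V] [MeasurableSpace V] [BorelSpace V]

theorem measurePreserving_planeRotation {e f : V} (he : ‖e‖ = 1) (hf : ‖f‖ = 1) (hef : inner ℝ e f = 0)
    (s : ℝ) :
    MeasurePreserving (planeRotation e f s) (volume : Measure V) volume :=
  ((planeRotationIsometry he hf hef s).toLinearIsometryEquiv rfl).measurePreserving

end Rotation

/-! ### The mean of the indicator of a double wedge over one full turn -/

/-- Over a period, both cosines are nonpositive exactly on an arc of length `π - δ`, up to a null
set. -/
theorem intervalIntegral_cos_indicator {δ : ℝ} (hδ : 0 ≤ δ) (hδ' : δ < Real.pi) (φ : ℝ) :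
    ∫ s in (0 : ℝ)..(2 * Real.pi),
      (if Real.cos (s + φ) ≤ 0 ∧ Real.cos (s + φ - δ) ≤ 0 then (1 : ℝ) else 0) = Real.pi - δ := by
  have hpi := Real.pi_pos
  set F : ℝ → ℝ := fun t => if Real.cos t ≤ 0 ∧ Real.cos (t - δ) ≤ 0 then (1 : ℝ) else 0 with hF
  have hper : Function.Periodic F (2 * Real.pi) := by
    intro t
    simp only [hF, Real.cos_add_two_pi, add_sub_right_comm]
  have h1 : ∫ s in (0 : ℝ)..(2 * Real.pi), F (s + φ) = ∫ t in φ..(φ + 2 * Real.pi), F t := by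
    rw [intervalIntegral.integral_comp_add_right]
    congr 1 <;> ring
  change ∫ s in (0 : ℝ)..(2 * Real.pi), F (s + φ) = _
  -- Starting the period at `π/2` makes the arc a single interval.
  rw [h1, hper.intervalIntegral_add_eq φ (Real.pi / 2),
    intervalIntegral.integral_of_le (by linarith)]
  -- The right endpoint is excluded because the cosine vanishes there; for `δ = 0` the two sides
  -- differ at that point.
  have h2 : ∀ t ∈ Set.Ioc (Real.pi / 2) (Real.pi / 2 + 2 * Real.pi) \ {5 * Real.pi / 2},
      F t = Set.indicator (Set.Icc (Real.pi / 2 + δ) (3 * Real.pi / 2)) (fun _ => (1 : ℝ)) t := by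
    rintro t ⟨⟨ht1, ht2⟩, ht3⟩
    have ht3' : t < 5 * Real.pi / 2 :=
      lt_of_le_of_ne (by linarith) (by simpa using ht3)
    by_cases h : t ≤ 3 * Real.pi / 2
    · have hc : Real.cos t ≤ 0 := Real.cos_nonpos_of_pi_div_two_le_of_le ht1.le (by linarith)
      by_cases h' : Real.pi / 2 + δ ≤ t
      · have hc' : Real.cos (t - δ) ≤ 0 :=
          Real.cos_nonpos_of_pi_div_two_le_of_le (by linarith) (by linarith)
        rw [Set.indicator_of_mem (show t ∈ Set.Icc _ _ from ⟨h', h⟩)]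
        simp [hF, hc, hc']
      · have hc' : 0 < Real.cos (t - δ) :=
          Real.cos_pos_of_mem_Ioo ⟨by linarith, by linarith⟩
        rw [Set.indicator_of_notMem (fun hm : t ∈ Set.Icc _ _ => h' hm.1)]
        simp [hF, hc'.not_ge]
    · have hc : 0 < Real.cos t := by
        rw [← Real.cos_sub_two_pi]
        exact Real.cos_pos_of_mem_Ioo ⟨by linarith, by linarith⟩
      rw [Set.indicator_of_notMem (fun hm : t ∈ Set.Icc _ _ => h hm.2)]
      simp [hF, hc.not_ge]
  have h3 : ∀ᵐ t ∂(volume.restrict (Set.Ioc (Real.pi / 2) (Real.pi / 2 + 2 * Real.pi))),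
      F t = Set.indicator (Set.Icc (Real.pi / 2 + δ) (3 * Real.pi / 2)) (fun _ => (1 : ℝ)) t := by
    rw [ae_restrict_iff' measurableSet_Ioc]
    have : ∀ᵐ t : ℝ, t ≠ 5 * Real.pi / 2 := by
      simp [ae_iff]
    filter_upwards [this] with t ht ht'
    exact h2 t ⟨ht', ht⟩
  rw [integral_congr_ae h3, show (fun _ : ℝ => (1 : ℝ)) = 1 from rfl,
    integral_indicator_one measurableSet_Icc, measureReal_restrict_apply
    measurableSet_Icc]
  have h4 : (Set.Icc (Real.pi / 2 + δ) (3 * Real.pi / 2) ∩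
      Set.Ioc (Real.pi / 2) (Real.pi / 2 + 2 * Real.pi) : Set ℝ) =ᵐ[volume]
      Set.Icc (Real.pi / 2 + δ) (3 * Real.pi / 2) := by
    have : ∀ᵐ t : ℝ, t ≠ Real.pi / 2 := by simp [ae_iff]
    filter_upwards [this] with t ht
    apply propext
    constructor
    · exact fun h => h.1
    · exact fun h => ⟨h, lt_of_le_of_ne (by linarith [h.1]) (Ne.symm ht), by linarith [h.2]⟩
  rw [measureReal_congr h4, Real.volume_real_Icc_of_le (by linarith)]
  ring

/-- In polar form, rotating `(a, b)` by `s` gives `‖w‖ (cos (s + arg w), sin (s + arg w))`. The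
second linear form is then `‖w‖ cos (s + arg w - δ)`. -/
theorem intervalIntegral_wedge {δ : ℝ} (hδ : 0 ≤ δ) (hδ' : δ < Real.pi) {a b : ℝ}
    (hab : a ≠ 0 ∨ b ≠ 0) :
    ∫ s in (0 : ℝ)..(2 * Real.pi),
      (if Real.cos s * a - Real.sin s * b ≤ 0 ∧
        Real.cos δ * (Real.cos s * a - Real.sin s * b) +
          Real.sin δ * (Real.sin s * a + Real.cos s * b) ≤ 0 then (1 : ℝ) else 0) =
      Real.pi - δ := by
  set w : ℂ := ⟨a, b⟩ with hw
  have hw0 : w ≠ 0 := by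
    intro h
    rcases hab with h' | h'
    · exact h' (congrArg Complex.re h)
    · exact h' (congrArg Complex.im h)
  have hr : 0 < ‖w‖ := norm_pos_iff.2 hw0
  have ha : a = ‖w‖ * Real.cos w.arg := by rw [Complex.norm_mul_cos_arg]
  have hb : b = ‖w‖ * Real.sin w.arg := by rw [Complex.norm_mul_sin_arg]
  rw [← intervalIntegral_cos_indicator hδ hδ' w.arg]
  congr 1
  ext s
  have e1 : Real.cos s * a - Real.sin s * b = ‖w‖ * Real.cos (s + w.arg) := by
    rw [Real.cos_add]
    linear_combination Real.cos s * ha - Real.sin s * hb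
  have e2 : Real.sin s * a + Real.cos s * b = ‖w‖ * Real.sin (s + w.arg) := by
    rw [Real.sin_add]
    linear_combination Real.sin s * ha + Real.cos s * hb
  have e3 : Real.cos δ * (‖w‖ * Real.cos (s + w.arg)) + Real.sin δ * (‖w‖ * Real.sin (s + w.arg)) =
      ‖w‖ * Real.cos (s + w.arg - δ) := by
    rw [Real.cos_sub]; ring
  rw [e1, e2, e3]
  simp only [mul_nonpos_iff_pos_imp_nonpos, hr, hr.le, true_implies]
  simp

theorem volume_inner_eq_zero {V : Type*} [NormedAddCommGroup V] [InnerProductSpace ℝ V]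
    [FiniteDimensional ℝ V] [MeasurableSpace V] [BorelSpace V] {u : V} (hu : u ≠ 0) :
    (volume : Measure V) {x | inner ℝ u x = 0} = 0 := by
  have h := Measure.addHaar_submodule (volume : Measure V) (ℝ ∙ u)ᗮ (by
    intro h
    have : u ∈ (ℝ ∙ u)ᗮ := by rw [h]; trivial
    rw [Submodule.mem_orthogonal_singleton_iff_inner_right] at this
    exact hu (inner_self_eq_zero.1 this))
  convert h using 2
  ext x
  simp [Submodule.mem_orthogonal_singleton_iff_inner_right]

/-- The map `x ↦ -x` exchanges the two half-balls, up to the null hyperplane between them. -/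
theorem volume_ball_inter_halfspace {V : Type*} [NormedAddCommGroup V] [InnerProductSpace ℝ V]
    [FiniteDimensional ℝ V] [MeasurableSpace V] [BorelSpace V] {w : V} (hw : w ≠ 0) :
    2 * (volume : Measure V).real (Metric.ball 0 1 ∩ {x | inner ℝ w x ≤ 0}) =
      (volume : Measure V).real (Metric.ball 0 1) := by
  have hm : MeasurableSet (Metric.ball (0 : V) 1 ∩ {x | inner ℝ w x ≤ 0}) :=
    measurableSet_ball.inter (measurableSet_le (f := fun x : V => inner ℝ w x)
      (g := fun _ => 0) (by fun_prop) measurable_const)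
  have hneg := (Measure.measurePreserving_neg (volume : Measure (V))).measureReal_preimage
    hm.nullMeasurableSet
  have hcompl : (Metric.ball (0 : V) 1 \ (Metric.ball (0 : V) 1 ∩ {x | inner ℝ w x ≤ 0}) :
      Set (V)) =ᵐ[volume] Neg.neg ⁻¹' (Metric.ball (0 : V) 1 ∩ {x | inner ℝ w x ≤ 0}) := by
    have h0 : ∀ᵐ x ∂(volume : Measure (V)), inner ℝ w x ≠ 0 := by
      rw [ae_iff]
      simp [volume_inner_eq_zero hw]
    filter_upwards [h0] with x hx
    apply propext
    change x ∈ (Metric.ball (0 : V) 1 \ (Metric.ball (0 : V) 1 ∩ {x | inner ℝ w x ≤ 0})) ↔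
      x ∈ Neg.neg ⁻¹' (Metric.ball (0 : V) 1 ∩ {x | inner ℝ w x ≤ 0})
    simp only [Set.mem_sdiff, Set.mem_inter_iff, Metric.mem_ball, dist_zero_right,
      Set.mem_ofPred_eq, Set.mem_preimage, norm_neg, inner_neg_right, not_and, not_le]
    constructor
    · exact fun h => ⟨h.1, by linarith [h.2 h.1]⟩
    · exact fun h => ⟨h.1, fun _ => lt_of_le_of_ne (by linarith [h.2]) (Ne.symm hx)⟩
  have hd := measureReal_sdiff_add_inter (μ := (volume : Measure (V))) (s := Metric.ball (0 : V) 1)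
    hm measure_ball_lt_top.ne
  rw [measureReal_congr hcompl, hneg, Set.inter_eq_self_of_subset_right Set.inter_subset_left] at hd
  linarith

/-- Rotations in the plane of `e` and `f` preserve the ball and its volume, and almost every orbit
spends `π - δ` out of `2π` in the wedge. Fubini over angle and point then gives the volume in any
dimension, without spherical coordinates. -/
theorem volume_ball_inter_wedge {V : Type*} [NormedAddCommGroup V] [InnerProductSpace ℝ V]
    [FiniteDimensional ℝ V] [MeasurableSpace V] [BorelSpace V] {e f : V} (he : ‖e‖ = 1)
    (hf : ‖f‖ = 1) (hef : inner ℝ e f = 0) {δ : ℝ} (hδ : 0 ≤ δ) (hδ' : δ < Real.pi) :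
    2 * Real.pi * (volume : Measure V).real (Metric.ball 0 1 ∩
      {x | inner ℝ e x ≤ 0 ∧ Real.cos δ * inner ℝ e x + Real.sin δ * inner ℝ f x ≤ 0}) =
      (Real.pi - δ) * (volume : Measure V).real (Metric.ball 0 1) := by
  have hpi := Real.pi_pos
  set C : Set V :=
    {x | inner ℝ e x ≤ 0 ∧ Real.cos δ * inner ℝ e x + Real.sin δ * inner ℝ f x ≤ 0} with hC
  set ν : Measure V := volume.restrict (Metric.ball 0 1) with hν
  have : IsFiniteMeasure ν := ⟨by
    rw [hν, Measure.restrict_apply_univ]; exact measure_ball_lt_top⟩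
  have hCm : MeasurableSet C := by
    exact (measurableSet_le (f := fun x : V => inner ℝ e x) (g := fun _ => 0)
      (by fun_prop) measurable_const).inter
      (measurableSet_le (f := fun x : V => Real.cos δ * inner ℝ e x + Real.sin δ * inner ℝ f x)
        (g := fun _ => 0) (by fun_prop) measurable_const)
  have hmp : ∀ s, MeasurePreserving (planeRotation e f s) ν ν := by
    intro s
    have h := (measurePreserving_planeRotation he hf hef s).restrict_preimage
      (Metric.isOpen_ball (x := (0 : V)) (ε := 1)).measurableSet
    have h' : planeRotation e f s ⁻¹' Metric.ball 0 1 = Metric.ball 0 1 := by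
      ext x
      simp [norm_planeRotation he hf hef]
    rwa [h'] at h
  set G : ℝ → V → ℝ := fun s x => C.indicator (fun _ => (1 : ℝ)) (planeRotation e f s x) with hG
  have hGm : Measurable (Function.uncurry G) := by
    have : Measurable fun p : ℝ × V => planeRotation e f p.1 p.2 := by
      unfold planeRotation
      fun_prop
    exact (measurable_const.indicator hCm).comp this
  have hswap := integral_integral_swap (μ := volume.restrict (Set.Ioc 0 (2 * Real.pi))) (ν := ν)
    (f := G) (by
      refine Integrable.of_bound hGm.aestronglyMeasurable 1 (ae_of_all _ fun p => ?_)
      simp only [Function.uncurry, hG]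
      by_cases h : planeRotation e f p.1 p.2 ∈ C <;> simp [h])
  have hleft : ∀ s, ∫ x, G s x ∂ν = ν.real C := by
    intro s
    have h1 : ∫ x, G s x ∂ν = ∫ x, C.indicator (fun _ => (1 : ℝ)) x ∂(ν.map (planeRotation e f s)) :=
      (integral_map (hmp s).aemeasurable
        (by rw [(hmp s).map_eq]
            exact ((measurable_const (a := (1 : ℝ))).indicator hCm).aestronglyMeasurable)).symm
    rw [h1, (hmp s).map_eq]
    exact integral_indicator_one hCm
  have hright : ∀ᵐ x ∂ν, ∫ s in Set.Ioc 0 (2 * Real.pi), G s x = Real.pi - δ := by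
    have he0 : e ≠ 0 := by
      intro h
      simp [h] at he
    have h0 : ∀ᵐ x ∂(volume : Measure V), inner ℝ e x ≠ 0 := by
      rw [ae_iff]
      simp [volume_inner_eq_zero he0]
    filter_upwards [ae_restrict_of_ae h0] with x hx
    rw [← intervalIntegral_wedge hδ hδ' (Or.inl hx : _ ∨ inner ℝ f x ≠ 0),
      intervalIntegral.integral_of_le (by positivity)]
    refine integral_congr_ae (ae_of_all _ fun s => ?_)
    simp only [hG, hC, Set.indicator_apply, Set.mem_ofPred_eq, inner_left_planeRotation he hef,
      inner_right_planeRotation hf hef]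
  rw [integral_congr_ae hright] at hswap
  simp only [hleft, integral_const, smul_eq_mul] at hswap
  rw [measureReal_restrict_apply_univ, Real.volume_real_Ioc_of_le (by positivity), hν,
    measureReal_restrict_apply_univ, measureReal_restrict_apply hCm, Set.inter_comm C] at hswap
  linarith

/-! ### The uniform measure on the sphere -/

/-- `toSphere` measures a set by the volume of the cone over it inside the unit ball, times the
dimension. For a trace of `K` that cone is `ball ∩ K` without the origin, and the dimension cancels
in the normalization. -/
theorem sphereUnif_apply_cone {d : ℕ} (hd : 1 ≤ d) {K : Set (E d)} (hK : MeasurableSet K)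
    (hcone : ∀ r : ℝ, 0 < r → ∀ x ∈ K, r • x ∈ K) :
    sphereUnif d {β | (β : E d) ∈ K} =
      (volume : Measure (E d)) (Metric.ball 0 1 ∩ K) / (volume : Measure (E d)) (Metric.ball 0 1) := by
  have hd0 : (d : ENNReal) ≠ 0 := by simp; omega
  have hset : (Set.Ioo (0 : ℝ) 1 • (Subtype.val '' {β : Metric.sphere (0 : E d) 1 | (β : E d) ∈ K}))
      = (Metric.ball 0 1 ∩ K) \ {0} := by
    ext x
    simp only [Set.mem_smul, Set.mem_image, Set.mem_ofPred_eq, Set.mem_sdiff, Set.mem_inter_iff,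
      Metric.mem_ball, dist_zero_right, Set.mem_singleton_iff]
    constructor
    · rintro ⟨r, hr, _, ⟨β, hβ, rfl⟩, rfl⟩
      have hn : ‖(β : E d)‖ = 1 := by simp
      refine ⟨⟨?_, hcone r hr.1 _ hβ⟩, ?_⟩
      · rw [norm_smul, hn, mul_one, Real.norm_of_nonneg hr.1.le]; exact hr.2
      · rw [smul_eq_zero, not_or]
        exact ⟨hr.1.ne', fun h => by simp [h] at hn⟩
    · rintro ⟨⟨h1, h2⟩, h3⟩
      have hn : 0 < ‖x‖ := norm_pos_iff.2 h3
      refine ⟨‖x‖, ⟨hn, h1⟩, ‖x‖⁻¹ • x, ⟨⟨‖x‖⁻¹ • x, ?_⟩, ?_, rfl⟩, ?_⟩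
      · simp [norm_smul, hn.ne']
      · exact hcone _ (inv_pos.2 hn) _ h2
      · rw [smul_smul, mul_inv_cancel₀ hn.ne', one_smul]
  have : Nonempty (Fin d) := ⟨⟨0, hd⟩⟩
  have hball0 : (volume : Measure (E d)) (Metric.ball 0 1) ≠ 0 :=
    (Metric.measure_ball_pos _ _ one_pos).ne'
  have hballt : (volume : Measure (E d)) (Metric.ball 0 1) ≠ ⊤ := measure_ball_lt_top.ne
  have hdt : (d : ENNReal) ≠ ⊤ := ENNReal.natCast_ne_top d
  rw [sphereUnif, Measure.smul_apply, Measure.toSphere_apply' _ (show MeasurableSet {β : Metric.sphere (0 : E d) 1 | (β : E d) ∈ K}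
      from measurable_subtype_coe hK), hset,
    Measure.toSphere_apply_univ, finrank_euclideanSpace_fin, smul_eq_mul,
    measure_sdiff_null (measure_singleton _), ← mul_assoc, ENNReal.div_eq_inv_mul,
    ENNReal.mul_inv (Or.inl hd0) (Or.inl hdt), mul_right_comm (d : ENNReal)⁻¹, ENNReal.inv_mul_cancel hd0 hdt,
    one_mul]

theorem isProbabilityMeasure_sphereUnif {d : ℕ} (hd : 1 ≤ d) :
    IsProbabilityMeasure (sphereUnif d) := by
  constructor
  have h := sphereUnif_apply_cone hd (K := Set.univ) MeasurableSet.univ (by simp)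
  simp only [Set.mem_univ, Set.ofPred_true, Set.inter_univ] at h
  have : Nonempty (Fin d) := ⟨⟨0, hd⟩⟩
  rw [h, ENNReal.div_self (Metric.measure_ball_pos _ _ one_pos).ne' measure_ball_lt_top.ne]

theorem ae_sphereUnif_inner_ne_zero {d : ℕ} (hd : 1 ≤ d) {u : E d} (hu : u ≠ 0) :
    ∀ᵐ β : Metric.sphere (0 : E d) 1 ∂(sphereUnif d), inner ℝ (β : E d) u ≠ 0 := by
  have h := sphereUnif_apply_cone hd (K := {x : E d | inner ℝ u x = 0})
    (measurableSet_eq_fun (f := fun x : E d => inner ℝ u x) (g := fun _ => 0)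
      (by fun_prop) measurable_const) (by
      intro r _ x hx
      simp only [Set.mem_ofPred_eq] at hx ⊢
      rw [inner_smul_right, hx, mul_zero])
  have h0 : (volume : Measure (E d)) (Metric.ball 0 1 ∩ {x | inner ℝ u x = 0}) = 0 :=
    measure_mono_null Set.inter_subset_right (volume_inner_eq_zero hu)
  rw [h0, ENNReal.zero_div] at h
  rw [ae_iff]
  convert h using 3
  simp only [not_not, Set.mem_ofPred_eq]
  funext β
  rw [real_inner_comm]

/-- The probability that a uniformly random direction makes an obtuse angle with both `u`
and `v`. -/
theorem sphereUnif_wedge {d : ℕ} (hd : 1 ≤ d) {u v : E d} (hu : u ≠ 0) (hv : v ≠ 0) :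
    (sphereUnif d).real {β : Metric.sphere (0 : E d) 1 | inner ℝ (β : E d) u ≤ 0 ∧ inner ℝ (β : E d) v ≤ 0} =
      1 / 2 - 1 / (2 * Real.pi) * InnerProductGeometry.angle u v := by
  have hpi := Real.pi_pos
  have : Nonempty (Fin d) := ⟨⟨0, hd⟩⟩
  set K : E d → E d → Set (E d) := fun u v => {x | inner ℝ u x ≤ 0 ∧ inner ℝ v x ≤ 0} with hKdef
  have hKm : ∀ u v, MeasurableSet (K u v) := fun u v =>
    (measurableSet_le (f := fun x : E d => inner ℝ u x) (g := fun _ => 0)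
      (by fun_prop) measurable_const).inter
      (measurableSet_le (f := fun x : E d => inner ℝ v x) (g := fun _ => 0)
        (by fun_prop) measurable_const)
  have hb : 0 < (volume : Measure (E d)).real (Metric.ball 0 1) :=
    ENNReal.toReal_pos (Metric.measure_ball_pos _ _ one_pos).ne' measure_ball_lt_top.ne
  have hcone : ∀ u v, ∀ r : ℝ, 0 < r → ∀ x ∈ K u v, r • x ∈ K u v := by
    intro u v r hr x hx
    simp only [hKdef, Set.mem_ofPred_eq, inner_smul_right] at hx ⊢
    exact ⟨mul_nonpos_of_nonneg_of_nonpos hr.le hx.1, mul_nonpos_of_nonneg_of_nonpos hr.le hx.2⟩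
  have h := sphereUnif_apply_cone hd (hKm u v) (hcone u v)
  have h' : (sphereUnif d).real {β : Metric.sphere (0 : E d) 1 | inner ℝ (β : E d) u ≤ 0 ∧ inner ℝ (β : E d) v ≤ 0} =
      (volume : Measure (E d)).real (Metric.ball 0 1 ∩ K u v) /
        (volume : Measure (E d)).real (Metric.ball 0 1) := by
    rw [measureReal_def, measureReal_def, measureReal_def, ← ENNReal.toReal_div, ← h]
    congr 3
    ext β
    simp only [hKdef, Set.mem_ofPred_eq, real_inner_comm (β : E d)]
  suffices hs : 2 * Real.pi * (volume : Measure (E d)).real (Metric.ball 0 1 ∩ K u v) =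
      (Real.pi - InnerProductGeometry.angle u v) *
        (volume : Measure (E d)).real (Metric.ball 0 1) by
    rw [h', div_eq_iff hb.ne']
    field_simp
    linarith
  have hhalf : ∀ w : E d, w ≠ 0 → 2 * (volume : Measure (E d)).real
      (Metric.ball 0 1 ∩ {x | inner ℝ w x ≤ 0}) =
        (volume : Measure (E d)).real (Metric.ball 0 1) :=
    fun w hw => volume_ball_inter_halfspace hw
  set δ := InnerProductGeometry.angle u v with hδ
  -- Parallel vectors, where `sin δ = 0`, span no plane and are treated directly: the wedge is a
  -- half-space for `δ = 0` and lies in a hyperplane for `δ = π`.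
  by_cases h0 : δ = 0
  · obtain ⟨_, r, hr, rfl⟩ := InnerProductGeometry.angle_eq_zero_iff.1 h0
    have : K u (r • u) = {x | inner ℝ u x ≤ 0} := by
      ext x
      simp only [hKdef, Set.mem_ofPred_eq, inner_smul_left, conj_trivial, and_iff_left_iff_imp]
      exact fun h => mul_nonpos_of_nonneg_of_nonpos hr.le h
    rw [this, h0, ← hhalf u hu]
    ring
  by_cases h1 : δ = Real.pi
  · obtain ⟨_, r, hr, rfl⟩ := InnerProductGeometry.angle_eq_pi_iff.1 h1
    have : K u (r • u) ⊆ {x | inner ℝ u x = 0} := by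
      intro x hx
      simp only [hKdef, Set.mem_ofPred_eq, inner_smul_left, conj_trivial] at hx ⊢
      nlinarith [hx.1, hx.2]
    rw [h1, measureReal_def, measure_mono_null (Set.inter_subset_right.trans this)
      (volume_inner_eq_zero hu)]
    simp
  have hδ0 : 0 < δ := lt_of_le_of_ne (InnerProductGeometry.angle_nonneg u v) (Ne.symm h0)
  have hδ1 : δ < Real.pi := lt_of_le_of_ne (InnerProductGeometry.angle_le_pi u v) h1
  have hsin : 0 < Real.sin δ := Real.sin_pos_of_pos_of_lt_pi hδ0 hδ1
  have hnu : 0 < ‖u‖ := norm_pos_iff.2 hu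
  have hnv : 0 < ‖v‖ := norm_pos_iff.2 hv
  set e : E d := ‖u‖⁻¹ • u with he
  -- Gram–Schmidt: the component of the normalized `v` orthogonal to `e` has length `sin δ`.
  set f : E d := (Real.sin δ)⁻¹ • (‖v‖⁻¹ • v - Real.cos δ • e) with hf
  have hne : ‖e‖ = 1 := by simp [he, norm_smul, hnu.ne']
  have hnv1 : ‖(‖v‖⁻¹ • v)‖ = 1 := by simp [norm_smul, hnv.ne']
  have hev : inner ℝ e (‖v‖⁻¹ • v) = Real.cos δ := by
    rw [hδ, InnerProductGeometry.cos_angle, he, inner_smul_left, inner_smul_right, conj_trivial]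
    field_simp
  have hef : inner ℝ e f = 0 := by
    rw [hf, inner_smul_right, inner_sub_right, hev, inner_smul_right, real_inner_self_eq_norm_sq,
      hne]
    ring
  have hnf : ‖f‖ = 1 := by
    have : ‖f‖ ^ 2 = 1 := by
      rw [hf, norm_smul, mul_pow, norm_sub_sq_real, inner_smul_right, real_inner_comm, hev, hnv1,
        norm_smul, hne, Real.norm_eq_abs, Real.norm_eq_abs, mul_one, sq_abs, sq_abs]
      have hc := Real.sin_sq_add_cos_sq δ
      field_simp
      linarith
    exact (pow_eq_one_iff_of_nonneg (norm_nonneg f) two_ne_zero).1 this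
  rw [← volume_ball_inter_wedge hne hnf hef hδ0.le hδ1]
  congr 4
  ext x
  have e1 : inner ℝ e x = ‖u‖⁻¹ * inner ℝ u x := by rw [he, inner_smul_left, conj_trivial]
  have e2 : Real.cos δ * inner ℝ e x + Real.sin δ * inner ℝ f x = ‖v‖⁻¹ * inner ℝ v x := by
    simp only [hf, inner_smul_left, inner_sub_left, conj_trivial]
    field_simp
    ring
  simp only [hKdef, Set.mem_ofPred_eq]
  rw [e2, e1]
  simp only [mul_nonpos_iff_pos_imp_nonpos, inv_pos, inv_nonneg, hnu, hnv, true_implies]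
  simp

/-! ### The projected statistic and its comparison with a nonnegative statistic -/

/-- The indicator of `a ≤ b`. -/
def leInd (a b : ℝ) : ℝ := if a ≤ b then 1 else 0

/-- The indicator of `a < b`. -/
def ltInd (a b : ℝ) : ℝ := if a < b then 1 else 0

theorem leInd_nonneg (a b : ℝ) : 0 ≤ leInd a b := by unfold leInd; split_ifs <;> norm_num

theorem leInd_le_one (a b : ℝ) : leInd a b ≤ 1 := by unfold leInd; split_ifs <;> norm_num

theorem ltInd_nonneg (a b : ℝ) : 0 ≤ ltInd a b := by unfold ltInd; split_ifs <;> norm_num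

theorem ltInd_le_one (a b : ℝ) : ltInd a b ≤ 1 := by unfold ltInd; split_ifs <;> norm_num

theorem ltInd_le_leInd (a b : ℝ) : ltInd a b ≤ leInd a b := by
  unfold ltInd leInd
  split_ifs <;> first | (exfalso; linarith) | norm_num

/-- The one-dimensional kernel whose average over all directions is `kernel`. -/
def projKernel (a₁ a₂ b₁ b₂ : ℝ) : ℝ :=
  leInd a₁ b₁ * leInd a₂ b₁ + leInd b₁ a₁ * leInd b₂ a₁ - 2 / 3

/-- The one-dimensional analogue of `uStat`. -/
def projStat {m n : ℕ} (x : Fin m → ℝ) (y : Fin n → ℝ) : ℝ :=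
  1 / (((m : ℝ) * (m - 1)) * ((n : ℝ) * (n - 1))) *
    ∑ i ∈ (Finset.univ : Finset (Fin m)).offDiag, ∑ j ∈ (Finset.univ : Finset (Fin n)).offDiag,
      projKernel (x i.1) (x i.2) (y j.1) (y j.2)

/-- The left-continuous empirical distribution function. -/
def ecdf {m : ℕ} (x : Fin m → ℝ) (t : ℝ) : ℝ := (1 / (m : ℝ)) * ∑ i, ltInd (x i) t

/-- The squared distance of two empirical distribution functions in `L²` of the first one. -/
def vStat {m n : ℕ} (x : Fin m → ℝ) (y : Fin n → ℝ) : ℝ :=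
  (1 / (m : ℝ)) * ∑ k, (ecdf x (x k) - ecdf y (x k)) ^ 2

theorem vStat_nonneg {m n : ℕ} (x : Fin m → ℝ) (y : Fin n → ℝ) : 0 ≤ vStat x y :=
  mul_nonneg (by positivity) (Finset.sum_nonneg fun _ _ => sq_nonneg _)

theorem sum_offDiag_univ {ι : Type*} [Fintype ι] [DecidableEq ι] (F : ι → ι → ℝ) :
    ∑ p ∈ (Finset.univ : Finset ι).offDiag, F p.1 p.2 = ∑ i, ∑ j, F i j - ∑ i, F i i := by
  have h : ∑ p ∈ (Finset.univ : Finset ι).diag ∪ (Finset.univ : Finset ι).offDiag, F p.1 p.2 =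
      ∑ i, ∑ j, F i j := by
    rw [Finset.diag_union_offDiag, Finset.sum_product]
  rw [Finset.sum_union (Finset.disjoint_diag_offDiag _), Finset.sum_diag] at h
  linarith

theorem sum_offDiag_fst {ι : Type*} [Fintype ι] [DecidableEq ι] (f : ι → ℝ) :
    ∑ p ∈ (Finset.univ : Finset ι).offDiag, f p.1 = ((Fintype.card ι : ℝ) - 1) * ∑ i, f i := by
  rw [sum_offDiag_univ fun i _ => f i]
  simp only [Finset.sum_const, Finset.card_univ, nsmul_eq_mul, ← Finset.mul_sum]
  ring

/-- Each product in `projKernel` leaves one of the four indices unused; summing over it contributes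
a factor `n - 1` or `m - 1`. -/
theorem projStat_eq {m n : ℕ} (hm : 2 ≤ m) (hn : 2 ≤ n) (x : Fin m → ℝ) (y : Fin n → ℝ) :
    projStat x y =
      (∑ i ∈ (Finset.univ : Finset (Fin m)).offDiag, ∑ j, leInd (x i.1) (y j) * leInd (x i.2) (y j))
          / ((m : ℝ) * (m - 1) * n) +
        (∑ j ∈ (Finset.univ : Finset (Fin n)).offDiag,
          ∑ i, leInd (y j.1) (x i) * leInd (y j.2) (x i)) / ((n : ℝ) * (n - 1) * m) - 2 / 3 := by
  have hm' : (2 : ℝ) ≤ m := by exact_mod_cast hm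
  have hn' : (2 : ℝ) ≤ n := by exact_mod_cast hn
  have hm1 : (m : ℝ) - 1 ≠ 0 := by linarith
  have hn1 : (n : ℝ) - 1 ≠ 0 := by linarith
  have hm0 : (m : ℝ) ≠ 0 := by linarith
  have hn0 : (n : ℝ) ≠ 0 := by linarith
  have h1 : ∑ i ∈ (Finset.univ : Finset (Fin m)).offDiag,
      ∑ j ∈ (Finset.univ : Finset (Fin n)).offDiag, leInd (x i.1) (y j.1) * leInd (x i.2) (y j.1) =
      ((n : ℝ) - 1) * ∑ i ∈ (Finset.univ : Finset (Fin m)).offDiag,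
        ∑ j, leInd (x i.1) (y j) * leInd (x i.2) (y j) := by
    rw [Finset.mul_sum]
    refine Finset.sum_congr rfl fun i _ => ?_
    rw [sum_offDiag_fst fun j => leInd (x i.1) (y j) * leInd (x i.2) (y j), Fintype.card_fin]
  have h2 : ∑ i ∈ (Finset.univ : Finset (Fin m)).offDiag,
      ∑ j ∈ (Finset.univ : Finset (Fin n)).offDiag, leInd (y j.1) (x i.1) * leInd (y j.2) (x i.1) =
      ((m : ℝ) - 1) * ∑ j ∈ (Finset.univ : Finset (Fin n)).offDiag,
        ∑ i, leInd (y j.1) (x i) * leInd (y j.2) (x i) := by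
    rw [Finset.sum_comm, Finset.mul_sum]
    refine Finset.sum_congr rfl fun j _ => ?_
    rw [sum_offDiag_fst fun i => leInd (y j.1) (x i) * leInd (y j.2) (x i), Fintype.card_fin]
  have h3 : ∑ i ∈ (Finset.univ : Finset (Fin m)).offDiag,
      ∑ j ∈ (Finset.univ : Finset (Fin n)).offDiag, (2 / 3 : ℝ) =
      ((m : ℝ) * (m - 1)) * ((n : ℝ) * (n - 1)) * (2 / 3) := by
    rw [sum_offDiag_fst fun _ => ∑ j ∈ (Finset.univ : Finset (Fin n)).offDiag, (2 / 3 : ℝ),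
      sum_offDiag_fst fun _ => (2 / 3 : ℝ)]
    simp only [Finset.sum_const, Finset.card_univ, Fintype.card_fin, nsmul_eq_mul]
    ring
  unfold projStat projKernel
  simp only [Finset.sum_sub_distrib, Finset.sum_add_distrib]
  rw [h1, h2, h3]
  field_simp

theorem projStat_comm {m n : ℕ} (hm : 2 ≤ m) (hn : 2 ≤ n) (x : Fin m → ℝ) (y : Fin n → ℝ) :
    projStat x y = projStat y x := by
  rw [projStat_eq hm hn, projStat_eq hn hm]
  ring

/-- Among three indices at most one can lie strictly above both others, and the three choices give
equal sums. Strictness makes this valid in the presence of ties. -/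
theorem sum_ltInd_mul_self_le {m : ℕ} (x : Fin m → ℝ) :
    3 * ∑ k, ∑ i, ∑ l, ltInd (x i) (x k) * ltInd (x l) (x k) ≤ (m : ℝ) ^ 3 := by
  have e1 : ∑ k, ∑ i, ∑ l, ltInd (x i) (x k) * ltInd (x l) (x k) =
      ∑ k, ∑ i, ∑ l, ltInd (x k) (x i) * ltInd (x l) (x i) := Finset.sum_comm
  have e2 : ∑ k, ∑ i, ∑ l, ltInd (x i) (x k) * ltInd (x l) (x k) =
      ∑ k, ∑ i, ∑ l, ltInd (x i) (x l) * ltInd (x k) (x l) := by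
    rw [Finset.sum_comm]
    rw [Finset.sum_comm (f := fun k i => ∑ l, ltInd (x i) (x l) * ltInd (x k) (x l))]
    exact Finset.sum_congr rfl fun i _ => Finset.sum_comm
  have h : ∑ k, ∑ i, ∑ l, (ltInd (x i) (x k) * ltInd (x l) (x k) +
      ltInd (x k) (x i) * ltInd (x l) (x i) + ltInd (x i) (x l) * ltInd (x k) (x l)) ≤
      ∑ k : Fin m, ∑ i : Fin m, ∑ l : Fin m, (1 : ℝ) := by
    refine Finset.sum_le_sum fun k _ => Finset.sum_le_sum fun i _ => Finset.sum_le_sum fun l _ => ?_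
    unfold ltInd
    split_ifs <;> first | (exfalso; linarith) | norm_num
  simp only [Finset.sum_add_distrib, Finset.sum_const, Finset.card_univ, Fintype.card_fin,
    nsmul_eq_mul, mul_one] at h
  rw [← e1, ← e2] at h
  linarith

/-- For `x k ≠ x i`, either both are at most `y j`, or the larger of the two exceeds both `y j` and
the smaller one. The `m n` triples with `k = i` are given up. -/
theorem sum_ltInd_mul_cross_ge {m n : ℕ} {x : Fin m → ℝ} (hx : Function.Injective x)
    (y : Fin n → ℝ) :
    (m : ℝ) ^ 2 * n - ∑ k, ∑ i, ∑ j, leInd (x i) (y j) * leInd (x k) (y j) - m * n ≤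
      2 * ∑ k, ∑ i, ∑ j, ltInd (x i) (x k) * ltInd (y j) (x k) := by
  have e1 : ∑ k, ∑ i, ∑ j, ltInd (x i) (x k) * ltInd (y j) (x k) =
      ∑ k, ∑ i, ∑ j, ltInd (x k) (x i) * ltInd (y j) (x i) := Finset.sum_comm
  have h : ∑ k, ∑ i, ∑ j, (1 - leInd (x i) (y j) * leInd (x k) (y j) - if k = i then (1 : ℝ) else 0)
      ≤ ∑ k, ∑ i, ∑ j, (ltInd (x i) (x k) * ltInd (y j) (x k) +
        ltInd (x k) (x i) * ltInd (y j) (x i)) := by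
    refine Finset.sum_le_sum fun k _ => Finset.sum_le_sum fun i _ => Finset.sum_le_sum fun j _ => ?_
    by_cases hki : k = i
    · subst hki
      rw [if_pos rfl]
      have := mul_nonneg (leInd_nonneg (x k) (y j)) (leInd_nonneg (x k) (y j))
      have := mul_nonneg (ltInd_nonneg (x k) (x k)) (ltInd_nonneg (y j) (x k))
      linarith
    · rw [if_neg hki]
      have hne : x k ≠ x i := fun h => hki (hx h)
      unfold ltInd leInd
      rcases lt_or_gt_of_ne hne with h | h
      · rw [if_neg h.not_gt, if_pos h]
        split_ifs <;> first | (exfalso; linarith) | norm_num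
      · rw [if_neg h.not_gt, if_pos h]
        split_ifs <;> first | (exfalso; linarith) | norm_num
  simp only [Finset.sum_add_distrib, Finset.sum_sub_distrib, Finset.sum_const, Finset.card_univ,
    Fintype.card_fin, nsmul_eq_mul, mul_one, Finset.sum_ite_eq, Finset.mem_univ, if_true,
    mul_ite, mul_zero] at h
  rw [← e1] at h
  linarith

theorem vStat_eq {m n : ℕ} (hm : m ≠ 0) (hn : n ≠ 0) (x : Fin m → ℝ) (y : Fin n → ℝ) :
    vStat x y = (∑ k, ∑ i, ∑ l, ltInd (x i) (x k) * ltInd (x l) (x k)) / (m : ℝ) ^ 3 -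
      2 * (∑ k, ∑ i, ∑ j, ltInd (x i) (x k) * ltInd (y j) (x k)) / ((m : ℝ) ^ 2 * n) +
      (∑ k, ∑ j, ∑ l, ltInd (y j) (x k) * ltInd (y l) (x k)) / (m * (n : ℝ) ^ 2) := by
  have hm0 : (m : ℝ) ≠ 0 := by exact_mod_cast hm
  have hn0 : (n : ℝ) ≠ 0 := by exact_mod_cast hn
  simp only [← Finset.sum_mul_sum]
  unfold vStat ecdf
  simp only [Finset.mul_sum (s := (Finset.univ : Finset (Fin m))) (a := (2 : ℝ)), Finset.sum_div]
  rw [Finset.mul_sum, ← Finset.sum_sub_distrib, ← Finset.sum_add_distrib]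
  refine Finset.sum_congr rfl fun k _ => ?_
  field_simp
  ring

/-- Expanding the square in `vStat`, the pure `x` term is at most `1/3`, the cross term contributes
`-1` plus the first part of `projStat`, and the pure `y` term is at most the second part. The
constants `1/3 - 1` make the `-2/3` of `projKernel`; what remains are diagonal corrections. -/
theorem vStat_le_projStat {m n : ℕ} (hm : 2 ≤ m) (hn : 2 ≤ n) {x : Fin m → ℝ}
    (hx : Function.Injective x) (y : Fin n → ℝ) :
    vStat x y ≤ projStat x y + 2 * (1 / m + 1 / n) := by
  have hm' : (2 : ℝ) ≤ m := by exact_mod_cast hm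
  have hn' : (2 : ℝ) ≤ n := by exact_mod_cast hn
  -- Passing from all pairs to distinct pairs costs at most `1/p`, since the diagonal sum is at most
  -- `p q`.
  have hoff : ∀ {p q : ℕ} (hp : 2 ≤ p) (hq : 2 ≤ q) (u : Fin p → ℝ) (v : Fin q → ℝ),
      (∑ k, ∑ i, ∑ j, leInd (u i) (v j) * leInd (u k) (v j)) / ((p : ℝ) ^ 2 * q) ≤
      (∑ i ∈ (Finset.univ : Finset (Fin p)).offDiag, ∑ j, leInd (u i.1) (v j) * leInd (u i.2) (v j))
          / ((p : ℝ) * (p - 1) * q) + 1 / p := by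
    intro p q hp hq u v
    have hp' : (2 : ℝ) ≤ p := by exact_mod_cast hp
    have hq' : (2 : ℝ) ≤ q := by exact_mod_cast hq
    have hp1 : (0 : ℝ) < (p : ℝ) - 1 := by linarith
    rw [sum_offDiag_univ fun i k => ∑ j, leInd (u i) (v j) * leInd (u k) (v j),
      Finset.sum_comm (f := fun k i => ∑ j, leInd (u i) (v j) * leInd (u k) (v j))]
    set A := ∑ i, ∑ k, ∑ j, leInd (u i) (v j) * leInd (u k) (v j) with hA
    set D := ∑ i, ∑ j, leInd (u i) (v j) * leInd (u i) (v j) with hD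
    have hDle : D ≤ p * q := by
      calc D ≤ ∑ i : Fin p, ∑ j : Fin q, (1 : ℝ) :=
            Finset.sum_le_sum fun i _ => Finset.sum_le_sum fun j _ =>
              mul_le_one₀ (leInd_le_one _ _) (leInd_nonneg _ _) (leInd_le_one _ _)
        _ = p * q := by simp
    have hAD : 0 ≤ A - D := by
      rw [hA, hD, ← sum_offDiag_univ fun i k => ∑ j, leInd (u i) (v j) * leInd (u k) (v j)]
      exact Finset.sum_nonneg fun _ _ => Finset.sum_nonneg fun _ _ =>
        mul_nonneg (leInd_nonneg _ _) (leInd_nonneg _ _)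
    calc A / ((p : ℝ) ^ 2 * q) = (A - D) / ((p : ℝ) ^ 2 * q) + D / ((p : ℝ) ^ 2 * q) := by ring
      _ ≤ (A - D) / ((p : ℝ) * (p - 1) * q) + 1 / p := by
          apply add_le_add
          · apply div_le_div_of_nonneg_left hAD (by positivity)
            nlinarith [mul_pos (show (0 : ℝ) < p by linarith) (show (0 : ℝ) < q by linarith)]
          · rw [div_le_div_iff₀ (by positivity) (by linarith)]
            nlinarith
  have h1 := sum_ltInd_mul_self_le x
  have h2 := sum_ltInd_mul_cross_ge hx y
  have h3 : ∑ k, ∑ j, ∑ l, ltInd (y j) (x k) * ltInd (y l) (x k) ≤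
      ∑ l, ∑ j, ∑ k, leInd (y j) (x k) * leInd (y l) (x k) := by
    have : ∑ l, ∑ j, ∑ k, leInd (y j) (x k) * leInd (y l) (x k) =
        ∑ k, ∑ j, ∑ l, leInd (y j) (x k) * leInd (y l) (x k) := by
      rw [Finset.sum_comm, Finset.sum_comm (s := (Finset.univ : Finset (Fin m)))]
      exact Finset.sum_congr rfl fun j _ => Finset.sum_comm
    rw [this]
    exact Finset.sum_le_sum fun k _ => Finset.sum_le_sum fun j _ => Finset.sum_le_sum fun l _ =>
      mul_le_mul (ltInd_le_leInd _ _) (ltInd_le_leInd _ _) (ltInd_nonneg _ _) (leInd_nonneg _ _)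
  have h4 := hoff hm hn x y
  have h5 := hoff hn hm y x
  rw [vStat_eq (by omega) (by omega), projStat_eq hm hn]
  have hm0 : (0 : ℝ) < m := by linarith
  have hn0 : (0 : ℝ) < n := by linarith
  have h1' : (∑ k, ∑ i, ∑ l, ltInd (x i) (x k) * ltInd (x l) (x k)) / (m : ℝ) ^ 3 ≤ 1 / 3 := by
    rw [div_le_div_iff₀ (by positivity) (by norm_num)]
    linarith
  have h2' : 1 - (∑ k, ∑ i, ∑ j, leInd (x i) (y j) * leInd (x k) (y j)) / ((m : ℝ) ^ 2 * n) - 1 / m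
      ≤ 2 * (∑ k, ∑ i, ∑ j, ltInd (x i) (x k) * ltInd (y j) (x k)) / ((m : ℝ) ^ 2 * n) := by
    have := div_le_div_of_nonneg_right h2 (show 0 ≤ (m : ℝ) ^ 2 * n by positivity)
    refine le_trans (le_of_eq ?_) this
    field_simp
  have h3' : (∑ k, ∑ j, ∑ l, ltInd (y j) (x k) * ltInd (y l) (x k)) / (m * (n : ℝ) ^ 2) ≤
      (∑ l, ∑ j, ∑ k, leInd (y j) (x k) * leInd (y l) (x k)) / ((n : ℝ) ^ 2 * m) := by
    rw [mul_comm (m : ℝ)]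
    exact div_le_div_of_nonneg_right h3 (by positivity)
  -- The losses are `1/m` from the cross term and `1/m`, `1/n` from `hoff`; one more `1/n` makes the
  -- bound symmetric.
  have h6 : (0 : ℝ) < 1 / n := by positivity
  linarith

/-! ### The statistic as an average over directions -/

@[fun_prop]
theorem measurable_leInd {Ω : Type*} [MeasurableSpace Ω] {f g : Ω → ℝ} (hf : Measurable f)
    (hg : Measurable g) : Measurable fun ω => leInd (f ω) (g ω) :=
  Measurable.ite (measurableSet_le hf hg) measurable_const measurable_const

@[fun_prop]
theorem measurable_ltInd {Ω : Type*} [MeasurableSpace Ω] {f g : Ω → ℝ} (hf : Measurable f)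
    (hg : Measurable g) : Measurable fun ω => ltInd (f ω) (g ω) :=
  Measurable.ite (measurableSet_lt hf hg) measurable_const measurable_const

theorem integrable_leInd_mul {d : ℕ} (hd : 1 ≤ d) (x₁ x₂ y : E d) :
    Integrable (fun β : Metric.sphere (0 : E d) 1 =>
      leInd (inner ℝ (β : E d) x₁) (inner ℝ (β : E d) y) *
        leInd (inner ℝ (β : E d) x₂) (inner ℝ (β : E d) y)) (sphereUnif d) := by
  have := isProbabilityMeasure_sphereUnif hd
  refine Integrable.of_bound (Measurable.aestronglyMeasurable (by fun_prop)) 1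
    (ae_of_all _ fun β => ?_)
  rw [Real.norm_of_nonneg (mul_nonneg (leInd_nonneg _ _) (leInd_nonneg _ _))]
  exact mul_le_one₀ (leInd_le_one _ _) (leInd_nonneg _ _) (leInd_le_one _ _)

theorem integral_leInd_mul {d : ℕ} (hd : 1 ≤ d) {x₁ x₂ y : E d} (h₁ : x₁ ≠ y) (h₂ : x₂ ≠ y) :
    ∫ β : Metric.sphere (0 : E d) 1, leInd (inner ℝ (β : E d) x₁) (inner ℝ (β : E d) y) *
        leInd (inner ℝ (β : E d) x₂) (inner ℝ (β : E d) y) ∂(sphereUnif d) =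
      1 / 2 - 1 / (2 * Real.pi) * InnerProductGeometry.angle (x₁ - y) (x₂ - y) := by
  rw [← sphereUnif_wedge hd (sub_ne_zero.2 h₁) (sub_ne_zero.2 h₂)]
  have hm : MeasurableSet {β : Metric.sphere (0 : E d) 1 |
      inner ℝ (β : E d) (x₁ - y) ≤ 0 ∧ inner ℝ (β : E d) (x₂ - y) ≤ 0} :=
    (measurableSet_le (f := fun β : Metric.sphere (0 : E d) 1 => inner ℝ (β : E d) (x₁ - y))
      (g := fun _ => 0) (by fun_prop) measurable_const).inter
    (measurableSet_le (f := fun β : Metric.sphere (0 : E d) 1 => inner ℝ (β : E d) (x₂ - y))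
      (g := fun _ => 0) (by fun_prop) measurable_const)
  rw [← integral_indicator_one hm]
  refine integral_congr_ae (ae_of_all _ fun β => ?_)
  simp only [Set.indicator_apply, Set.mem_ofPred_eq, inner_sub_right, sub_nonpos, leInd,
    Pi.one_apply]
  split_ifs <;> simp_all

/-- Two wedge probabilities contribute `1/2` each, and subtracting `2/3` leaves the `1/3` of
`kernel`. Distinctness matters because `angle` takes the default value `π/2` at a zero vector, where
the wedge formula fails. -/
theorem kernel_eq_integral {d : ℕ} (hd : 1 ≤ d) {x₁ x₂ y₁ y₂ : E d} (h₁ : x₁ ≠ y₁) (h₂ : x₂ ≠ y₁)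
    (h₃ : y₂ ≠ x₁) :
    Integrable (fun β : Metric.sphere (0 : E d) 1 => projKernel (inner ℝ (β : E d) x₁)
      (inner ℝ (β : E d) x₂) (inner ℝ (β : E d) y₁) (inner ℝ (β : E d) y₂)) (sphereUnif d) ∧
    kernel x₁ x₂ y₁ y₂ = ∫ β : Metric.sphere (0 : E d) 1, projKernel (inner ℝ (β : E d) x₁)
      (inner ℝ (β : E d) x₂) (inner ℝ (β : E d) y₁) (inner ℝ (β : E d) y₂) ∂(sphereUnif d) := by
  have := isProbabilityMeasure_sphereUnif hd
  unfold projKernel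
  have i1 := integrable_leInd_mul hd x₁ x₂ y₁
  have i2 := integrable_leInd_mul hd y₁ y₂ x₁
  refine ⟨(i1.add i2).sub (integrable_const _), ?_⟩
  rw [integral_sub (i1.fun_add i2) (integrable_const _), integral_add i1 i2,
    integral_leInd_mul hd h₁ h₂, integral_leInd_mul hd h₁.symm h₃, kernel]
  simp only [integral_const, probReal_univ, smul_eq_mul]
  ring

theorem uStat_eq_integral {d m n : ℕ} (hd : 1 ≤ d) {z : Fin (m + n) → E d}
    (hz : Function.Injective z) :
    Integrable (fun β : Metric.sphere (0 : E d) 1 =>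
      projStat (fun i => inner ℝ (β : E d) (z (Fin.castAdd n i)))
        (fun j => inner ℝ (β : E d) (z (Fin.natAdd m j)))) (sphereUnif d) ∧
    uStat z = ∫ β : Metric.sphere (0 : E d) 1,
      projStat (fun i => inner ℝ (β : E d) (z (Fin.castAdd n i)))
        (fun j => inner ℝ (β : E d) (z (Fin.natAdd m j))) ∂(sphereUnif d) := by
  have hne : ∀ (i : Fin m) (j : Fin n), z (Fin.castAdd n i) ≠ z (Fin.natAdd m j) := by
    intro i j h
    have := congrArg Fin.val (hz h)
    simp only [Fin.val_castAdd, Fin.val_natAdd] at this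
    omega
  have hk := fun (i : Fin m × Fin m) (j : Fin n × Fin n) =>
    kernel_eq_integral hd (hne i.1 j.1) (hne i.2 j.1) (hne i.1 j.2).symm
  unfold projStat
  constructor
  · exact (integrable_finsetSum _ fun i _ => integrable_finsetSum _ fun j _ =>
      (hk i j).1).const_mul _
  · rw [uStat, integral_const_mul, integral_finsetSum _ fun i _ => integrable_finsetSum _ fun j _ =>
      (hk i j).1]
    congr 1
    refine Finset.sum_congr rfl fun i _ => ?_
    rw [integral_finsetSum _ fun j _ => (hk i j).1]
    exact Finset.sum_congr rfl fun j _ => (hk i j).2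

/-! ### Permutation distribution -/

/-- Reindexing the permutations by the 3-cycle on `a`, `b`, `c` shows that the three vertices of the
triangle contribute equal sums, and for each permutation the three angles add up to `π`. -/
theorem sum_perm_angle {V ι : Type*} [NormedAddCommGroup V] [InnerProductSpace ℝ V] [Fintype ι]
    [DecidableEq ι] {z : ι → V} (hz : Function.Injective z) {a b c : ι} (hab : a ≠ b)
    (hac : a ≠ c) (hbc : b ≠ c) :
    3 * ∑ ϖ : Equiv.Perm ι, InnerProductGeometry.angle (z (ϖ a) - z (ϖ c)) (z (ϖ b) - z (ϖ c)) =
      (Fintype.card ι).factorial * Real.pi := by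
  set S : ι → ι → ι → ℝ := fun a b c =>
    ∑ ϖ : Equiv.Perm ι, InnerProductGeometry.angle (z (ϖ a) - z (ϖ c)) (z (ϖ b) - z (ϖ c)) with hS
  have hτ : ∀ (τ : Equiv.Perm ι) (a b c : ι), S (τ a) (τ b) (τ c) = S a b c := fun τ a b c =>
    Equiv.sum_comp (Equiv.mulRight τ) fun ϖ : Equiv.Perm ι =>
      InnerProductGeometry.angle (z (ϖ a) - z (ϖ c)) (z (ϖ b) - z (ϖ c))
  set τ : Equiv.Perm ι := Equiv.swap a b * Equiv.swap b c with hτdef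
  have ha : τ a = b := by
    rw [hτdef, Equiv.Perm.mul_apply, Equiv.swap_apply_of_ne_of_ne hab hac, Equiv.swap_apply_left]
  have hb : τ b = c := by
    rw [hτdef, Equiv.Perm.mul_apply, Equiv.swap_apply_left,
      Equiv.swap_apply_of_ne_of_ne hac.symm hbc.symm]
  have hc : τ c = a := by
    rw [hτdef, Equiv.Perm.mul_apply, Equiv.swap_apply_right, Equiv.swap_apply_right]
  have h1 : S b c a = S a b c := by have := hτ τ a b c; rwa [ha, hb, hc] at this
  have h2 : S c a b = S a b c := by have := hτ τ b c a; rwa [ha, hb, hc, h1] at this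
  have h3 : S a b c + S c a b + S b c a = (Fintype.card ι).factorial * Real.pi := by
    rw [hS]
    simp only
    rw [← Finset.sum_add_distrib, ← Finset.sum_add_distrib, ← Fintype.card_perm, ← nsmul_eq_mul,
      Fintype.card, ← Finset.sum_const]
    refine Finset.sum_congr rfl fun ϖ _ => ?_
    have := EuclideanGeometry.angle_add_angle_add_angle_eq_pi (p₁ := z (ϖ a)) (p₂ := z (ϖ c))
      (z (ϖ b)) (fun h => hac (ϖ.injective (hz h)).symm)
    simpa only [EuclideanGeometry.angle, vsub_eq_sub] using this
  change 3 * S a b c = _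
  linarith

/-- Each angle has permutation mean `π/3`, so the kernel has mean `1/3 - 1/6 - 1/6 = 0`. -/
theorem sum_perm_uStat {d m n : ℕ} {z : Fin (m + n) → E d} (hz : Function.Injective z) :
    ∑ ϖ : Equiv.Perm (Fin (m + n)), uStat (m := m) (n := n) (z ∘ ϖ) = 0 := by
  unfold uStat
  rw [← Finset.mul_sum, Finset.sum_comm]
  refine mul_eq_zero_of_right _ (Finset.sum_eq_zero fun i hi => ?_)
  rw [Finset.sum_comm]
  refine Finset.sum_eq_zero fun j hj => ?_
  have hi' : Fin.castAdd n i.1 ≠ Fin.castAdd n i.2 := by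
    simpa [Finset.mem_offDiag] using hi
  have hj' : Fin.natAdd m j.1 ≠ Fin.natAdd m j.2 := by
    simpa [Finset.mem_offDiag] using hj
  have hne : ∀ (i : Fin m) (j : Fin n), Fin.castAdd n i ≠ Fin.natAdd m j := by
    intro i j h
    have := congrArg Fin.val h
    simp only [Fin.val_castAdd, Fin.val_natAdd] at this
    omega
  have h1 := sum_perm_angle hz hi' (hne i.1 j.1) (hne i.2 j.1)
  have h2 := sum_perm_angle hz hj' (hne i.1 j.1).symm (hne i.1 j.2).symm
  have hpi := Real.pi_pos
  simp only [kernel, Function.comp_apply, Finset.sum_sub_distrib, ← Finset.mul_sum,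
    Finset.sum_const, Finset.card_univ, Fintype.card_perm, nsmul_eq_mul]
  rw [Fintype.card_fin] at h1 h2 ⊢
  field_simp
  linarith

/-- Markov's inequality for the permutation distribution: if all permuted statistics are at least
`-K` and they sum to zero, then the critical value is at most `K / α`. -/
theorem critValue_le {d m n : ℕ} {α K : ℝ} (hα : 0 < α) (hα1 : α < 1) (hK : 0 < K)
    {z : Fin (m + n) → E d}
    (hlow : ∀ ϖ : Equiv.Perm (Fin (m + n)), -K ≤ uStat (m := m) (n := n) (z ∘ ϖ))
    (hsum : ∑ ϖ : Equiv.Perm (Fin (m + n)), uStat (m := m) (n := n) (z ∘ ϖ) = 0) :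
    critValue (m := m) (n := n) α z ≤ K / α := by
  have hN : (0 : ℝ) < ((m + n).factorial : ℝ) := by exact_mod_cast Nat.factorial_pos _
  -- Without a lower bound `sInf` would be the default `0`. Below `-K` the permutation distribution
  -- function is `0 < 1 - α`.
  have hbdd : BddBelow {t : ℝ | 1 - α ≤ permCDF (m := m) (n := n) z t} := by
    refine ⟨-K, fun t ht => ?_⟩
    by_contra hlt
    push Not at hlt
    have : permCDF (m := m) (n := n) z t = 0 := by
      unfold permCDF
      refine mul_eq_zero_of_right _ (Finset.sum_eq_zero fun ϖ _ => ?_)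
      refine Set.indicator_of_notMem (fun h => ?_) _
      have h' : uStat (m := m) (n := n) (z ∘ ϖ) ≤ t := h
      linarith [hlow ϖ]
    have ht' : 1 - α ≤ permCDF (m := m) (n := n) z t := ht
    linarith
  refine csInf_le hbdd ?_
  change 1 - α ≤ permCDF (m := m) (n := n) z (K / α)
  -- An affine minorant of the indicator of `u ≤ K / α`; as the statistics sum to zero, it averages
  -- to exactly `1 - α`.
  have hpt : ∀ ϖ : Equiv.Perm (Fin (m + n)),
      1 - α / K * (uStat (m := m) (n := n) (z ∘ ϖ) + K) ≤
        Set.indicator (Set.Iic (K / α)) (fun _ => (1 : ℝ)) (uStat (m := m) (n := n) (z ∘ ϖ)) := by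
    intro ϖ
    have h0 : 0 ≤ α / K * (uStat (m := m) (n := n) (z ∘ ϖ) + K) :=
      mul_nonneg (by positivity) (by linarith [hlow ϖ])
    by_cases h : uStat (m := m) (n := n) (z ∘ ϖ) ≤ K / α
    · rw [Set.indicator_of_mem (show uStat (m := m) (n := n) (z ∘ ϖ) ∈ Set.Iic (K / α) from h)]
      linarith
    · rw [Set.indicator_of_notMem
        (fun h' : uStat (m := m) (n := n) (z ∘ ϖ) ∈ Set.Iic (K / α) => h h')]
      push Not at h
      have : α / K * (K / α) ≤ α / K * (uStat (m := m) (n := n) (z ∘ ϖ) + K) :=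
        mul_le_mul_of_nonneg_left (by linarith) (by positivity)
      have h1 : α / K * (K / α) = 1 := by field_simp
      linarith
  have hs := Finset.sum_le_sum fun ϖ (_ : ϖ ∈ Finset.univ) => hpt ϖ
  rw [Finset.sum_sub_distrib, ← Finset.mul_sum, Finset.sum_add_distrib, hsum] at hs
  simp only [Finset.sum_const, Finset.card_univ, Fintype.card_perm, Fintype.card_fin,
    nsmul_eq_mul] at hs
  unfold permCDF
  rw [one_div, ← div_eq_inv_mul, le_div_iff₀ hN]
  refine le_trans (le_of_eq ?_) hs
  field_simp
  ring

/-! ### Lower bounds for the statistic -/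

theorem ae_injective_inner {d : ℕ} (hd : 1 ≤ d) {ι : Type*} [Countable ι] {x : ι → E d}
    (hx : Function.Injective x) :
    ∀ᵐ β : Metric.sphere (0 : E d) 1 ∂(sphereUnif d),
      Function.Injective fun i => inner ℝ (β : E d) (x i) := by
  have h : ∀ᵐ β : Metric.sphere (0 : E d) 1 ∂(sphereUnif d), ∀ i j, i ≠ j →
      inner ℝ (β : E d) (x i - x j) ≠ 0 := by
    rw [ae_all_iff]
    intro i
    rw [ae_all_iff]
    intro j
    by_cases hij : i = j
    · exact ae_of_all _ fun _ h => absurd hij h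
    · filter_upwards [ae_sphereUnif_inner_ne_zero hd (sub_ne_zero.2 (hx.ne hij))] with β hβ _
      exact hβ
  filter_upwards [h] with β hβ i j hij
  by_contra hne
  refine hβ i j hne ?_
  rw [inner_sub_right, sub_eq_zero]
  exact hij

@[fun_prop]
theorem measurable_ecdf {Ω : Type*} [MeasurableSpace Ω] {m : ℕ} {x : Fin m → Ω → ℝ} {t : Ω → ℝ}
    (hx : ∀ i, Measurable (x i)) (ht : Measurable t) :
    Measurable fun ω => ecdf (fun i => x i ω) (t ω) := by
  unfold ecdf
  fun_prop

theorem ecdf_nonneg {m : ℕ} (x : Fin m → ℝ) (t : ℝ) : 0 ≤ ecdf x t :=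
  mul_nonneg (by positivity) (Finset.sum_nonneg fun _ _ => ltInd_nonneg _ _)

theorem ecdf_le_one {m : ℕ} (x : Fin m → ℝ) (t : ℝ) : ecdf x t ≤ 1 := by
  unfold ecdf
  rw [one_div, ← div_eq_inv_mul]
  refine div_le_one_of_le₀ ?_ (by positivity)
  calc ∑ i, ltInd (x i) t ≤ ∑ i : Fin m, (1 : ℝ) := Finset.sum_le_sum fun _ _ => ltInd_le_one _ _
    _ = m := by simp

theorem sq_sub_le_one {a b : ℝ} (ha : 0 ≤ a) (ha' : a ≤ 1) (hb : 0 ≤ b) (hb' : b ≤ 1) :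
    (a - b) ^ 2 ≤ 1 := by
  rw [sq_le_one_iff_abs_le_one, abs_le]
  constructor <;> linarith

theorem integrable_vStat {d m n : ℕ} (hd : 1 ≤ d) (x : Fin m → E d) (y : Fin n → E d) :
    Integrable (fun β : Metric.sphere (0 : E d) 1 => vStat (fun i => inner ℝ (β : E d) (x i))
      (fun j => inner ℝ (β : E d) (y j))) (sphereUnif d) := by
  have := isProbabilityMeasure_sphereUnif hd
  unfold vStat
  refine (integrable_finsetSum _ fun k _ => Integrable.of_bound (Measurable.aestronglyMeasurable
    (by fun_prop)) 1 (ae_of_all _ fun β => ?_)).const_mul _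
  rw [Real.norm_of_nonneg (sq_nonneg _)]
  exact sq_sub_le_one (ecdf_nonneg _ _) (ecdf_le_one _ _) (ecdf_nonneg _ _) (ecdf_le_one _ _)

/-- `projStat` is symmetric in the two samples, so the comparison holds with either sample as the
integrating one. Mixing with weights `θ` and `1 - θ` matches the mixture `H_β` in the distance. -/
theorem integral_vStat_le_uStat {d m n : ℕ} (hd : 1 ≤ d) (hm : 2 ≤ m) (hn : 2 ≤ n) {θ : ℝ}
    (hθ : 0 ≤ θ) (hθ' : θ ≤ 1) {z : Fin (m + n) → E d} (hz : Function.Injective z) :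
    ∫ β : Metric.sphere (0 : E d) 1,
      (θ * vStat (fun i => inner ℝ (β : E d) (z (Fin.castAdd n i)))
          (fun j => inner ℝ (β : E d) (z (Fin.natAdd m j))) +
        (1 - θ) * vStat (fun j => inner ℝ (β : E d) (z (Fin.natAdd m j)))
          (fun i => inner ℝ (β : E d) (z (Fin.castAdd n i)))) ∂(sphereUnif d) ≤
      uStat (m := m) (n := n) z + 2 * (1 / m + 1 / n) := by
  have := isProbabilityMeasure_sphereUnif hd
  obtain ⟨hint, heq⟩ := uStat_eq_integral (m := m) (n := n) hd hz
  have hconst : ∫ _β : Metric.sphere (0 : E d) 1, 2 * (1 / (m : ℝ) + 1 / n) ∂(sphereUnif d) =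
      2 * (1 / m + 1 / n) := by
    rw [integral_const, probReal_univ, one_smul]
  rw [heq, ← hconst, ← integral_add hint (integrable_const _)]
  refine integral_mono_ae (((integrable_vStat hd _ _).const_mul _).add
    ((integrable_vStat hd _ _).const_mul _)) (hint.add (integrable_const _)) ?_
  filter_upwards [ae_injective_inner hd hz] with β hβ
  have h1 := vStat_le_projStat hm hn (hβ.comp (Fin.castAdd_injective m n))
    (fun j => inner ℝ (β : E d) (z (Fin.natAdd m j)))
  have h2 := vStat_le_projStat hn hm (hβ.comp (Fin.natAdd_injective n m))
    (fun i => inner ℝ (β : E d) (z (Fin.castAdd n i)))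
  rw [projStat_comm hn hm, add_comm (1 / (n : ℝ))] at h2
  have h1' := mul_le_mul_of_nonneg_left h1 hθ
  have h2' := mul_le_mul_of_nonneg_left h2 (sub_nonneg.2 hθ')
  simp only [Function.comp_def] at h1' h2'
  linarith

theorem uStat_ge {d m n : ℕ} (hd : 1 ≤ d) (hm : 2 ≤ m) (hn : 2 ≤ n) {z : Fin (m + n) → E d}
    (hz : Function.Injective z) : -(2 * (1 / m + 1 / n)) ≤ uStat (m := m) (n := n) z := by
  have h := integral_vStat_le_uStat hd hm hn zero_le_one le_rfl hz
  have h0 := le_trans (integral_nonneg fun β => ?_) h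
  · linarith
  · have := vStat_nonneg (fun i => inner ℝ (β : E d) (z (Fin.castAdd n i)))
      (fun j => inner ℝ (β : E d) (z (Fin.natAdd m j)))
    simpa using this

/-- Non-rejection means `uStat` is at most the critical value, hence at most `2r / α` with `r = 1/m
+ 1/n`. The comparison error `2r` is absorbed by another `2r / α`. -/
theorem integral_vStat_le_of_test_eq_zero {d m n : ℕ} (hd : 1 ≤ d) (hm : 2 ≤ m) (hn : 2 ≤ n)
    {α θ : ℝ} (hα : 0 < α) (hα' : α < 1) (hθ : 0 ≤ θ) (hθ' : θ ≤ 1) {z : Fin (m + n) → E d}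
    (hz : Function.Injective z) (htest : test (m := m) (n := n) α z = 0) :
    ∫ β : Metric.sphere (0 : E d) 1,
      (θ * vStat (fun i => inner ℝ (β : E d) (z (Fin.castAdd n i)))
          (fun j => inner ℝ (β : E d) (z (Fin.natAdd m j))) +
        (1 - θ) * vStat (fun j => inner ℝ (β : E d) (z (Fin.natAdd m j)))
          (fun i => inner ℝ (β : E d) (z (Fin.castAdd n i)))) ∂(sphereUnif d) ≤
      4 / α * (1 / m + 1 / n) := by
  have hm0 : (0 : ℝ) < m := by exact_mod_cast (by omega : 0 < m)
  have hn0 : (0 : ℝ) < n := by exact_mod_cast (by omega : 0 < n)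
  have hr : (0 : ℝ) < 1 / m + 1 / n := by positivity
  have hle : uStat (m := m) (n := n) z ≤ critValue (m := m) (n := n) α z := by
    by_contra h
    push Not at h
    simp [test, h] at htest
  have hcrit := critValue_le hα hα' (mul_pos two_pos hr)
    (fun ϖ => uStat_ge hd hm hn (hz.comp ϖ.injective)) (sum_perm_uStat (m := m) (n := n) hz)
  have h := integral_vStat_le_uStat hd hm hn hθ hθ' hz
  refine h.trans ?_
  have h1 : 2 * (1 / (m : ℝ) + 1 / n) ≤ 2 * (1 / m + 1 / n) / α := by
    rw [le_div_iff₀ hα]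
    nlinarith
  calc uStat (m := m) (n := n) z + 2 * (1 / m + 1 / n)
      ≤ 2 * (1 / m + 1 / n) / α + 2 * (1 / m + 1 / n) / α := by linarith
    _ = 4 / α * (1 / m + 1 / n) := by ring

/-! ### Integrating out one coordinate of a product measure -/

section Resample

variable {ι : Type*} [Fintype ι] [DecidableEq ι] {X : ι → Type*} [∀ i, MeasurableSpace (X i)]
  (μ : ∀ i, Measure (X i)) [∀ i, IsProbabilityMeasure (μ i)]

/-- Redrawing one coordinate independently preserves the product law, so that coordinate can be
integrated with the others frozen, without splitting the index type. -/
theorem measurePreserving_update (i : ι) :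
    MeasurePreserving (fun p : (∀ j, X j) × X i => Function.update p.1 i p.2)
      ((Measure.pi μ).prod (μ i)) (Measure.pi μ) := by
  have hm : Measurable fun p : (∀ j, X j) × X i => Function.update p.1 i p.2 := by
    refine measurable_pi_iff.2 fun j => ?_
    by_cases h : j = i
    · subst h
      simpa using measurable_snd
    · simp only [Function.update_of_ne h]
      exact (measurable_pi_apply j).comp measurable_fst
  refine ⟨hm, (Measure.pi_eq fun s hs => ?_).symm⟩
  rw [Measure.map_apply hm (MeasurableSet.univ_pi hs)]
  have hpre : (fun p : (∀ j, X j) × X i => Function.update p.1 i p.2) ⁻¹' Set.univ.pi s =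
      (Set.univ.pi (Function.update s i Set.univ)) ×ˢ s i := by
    ext p
    simp only [Set.mem_preimage, Set.mem_pi, Set.mem_univ, true_implies, Set.mem_prod]
    constructor
    · intro h
      refine ⟨fun j => ?_, by simpa using h i⟩
      by_cases hj : j = i
      · subst hj; simp
      · simpa [Function.update_of_ne hj] using h j
    · rintro ⟨h1, h2⟩ j
      by_cases hj : j = i
      · subst hj; simpa using h2
      · simpa [Function.update_of_ne hj] using h1 j
  rw [hpre, Measure.prod_prod, Measure.pi_pi, ← Finset.prod_erase_mul _ _ (Finset.mem_univ i),
    ← Finset.prod_erase_mul (a := i) _ (fun j => μ j (s j)) (Finset.mem_univ i)]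
  congr 1
  rw [Function.update_self, measure_univ, mul_one]
  refine Finset.prod_congr rfl fun j hj => ?_
  rw [Function.update_of_ne (Finset.ne_of_mem_erase hj)]

theorem integral_pi_eq_zero_of_update {i : ι} {f : (∀ j, X j) → ℝ} (hf : Integrable f (Measure.pi μ))
    (h : ∀ ω, ∫ x, f (Function.update ω i x) ∂(μ i) = 0) : ∫ ω, f ω ∂(Measure.pi μ) = 0 := by
  have hmp := measurePreserving_update μ i
  have h1 : ∫ ω, f ω ∂(Measure.pi μ) =
      ∫ p : (∀ j, X j) × X i, f (Function.update p.1 i p.2) ∂((Measure.pi μ).prod (μ i)) := by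
    conv_lhs => rw [← hmp.map_eq]
    exact integral_map hmp.aemeasurable (by rw [hmp.map_eq]; exact hf.aestronglyMeasurable)
  have hi : Integrable (fun p : (∀ j, X j) × X i => f (Function.update p.1 i p.2))
      ((Measure.pi μ).prod (μ i)) := hmp.integrable_comp_of_integrable hf
  rw [h1, integral_prod _ hi]
  simp [h]

end Resample

/-- Independent points drawn from atomless laws are almost surely distinct. -/
theorem ae_injective_pi {ι X : Type*} [Fintype ι] [MeasurableSpace X] [MeasurableEq X]
    (μ : ι → Measure X) [∀ i, IsProbabilityMeasure (μ i)] (hμ : ∀ i x, μ i {x} = 0) :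
    ∀ᵐ ω ∂(Measure.pi μ), Function.Injective ω := by
  classical
  have h : ∀ᵐ ω ∂(Measure.pi μ), ∀ i j, i ≠ j → ω i ≠ ω j := by
    rw [ae_all_iff]
    intro i
    rw [ae_all_iff]
    intro j
    by_cases hij : i = j
    · exact ae_of_all _ fun _ h => absurd hij h
    suffices hs : ∀ᵐ ω ∂(Measure.pi μ), ω i ≠ ω j by
      filter_upwards [hs] with ω hω _
      exact hω
    have hms : MeasurableSet {ω : ι → X | ω i = ω j} :=
      measurableSet_eq_fun (measurable_pi_apply i) (measurable_pi_apply j)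
    have hmp := measurePreserving_update μ i
    rw [ae_iff]
    simp only [ne_eq, not_not]
    rw [← hmp.measure_preimage hms.nullMeasurableSet, Measure.measure_prod_null (hmp.measurable hms)]
    refine ae_of_all _ fun ω => ?_
    change μ i _ = 0
    convert hμ i (ω j) using 2
    ext x
    simp [Function.update_of_ne (Ne.symm hij)]
  filter_upwards [h] with ω hω i j hij
  by_contra hne
  exact hω i j hne hij

/-- Second moment of an average of conditionally centred bounded terms. -/
theorem integral_sq_average_le {ι κ X : Type*} [Fintype ι] [Fintype κ] [DecidableEq ι]
    [MeasurableSpace X] (μ : ι → Measure X) [∀ i, IsProbabilityMeasure (μ i)] {P : Measure X}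
    {e : κ → ι} (he : Function.Injective e) (heP : ∀ a, μ (e a) = P) {φ : X → X → ℝ}
    (hφ : Measurable (Function.uncurry φ)) (hφ1 : ∀ x y, |φ x y| ≤ 1)
    (hφ0 : ∀ y, ∫ x, φ x y ∂P = 0) (k : ι) :
    ∫ ω, ((1 / (Fintype.card κ : ℝ)) * ∑ a, φ (ω (e a)) (ω k)) ^ 2 ∂(Measure.pi μ) ≤
      3 * (1 / (Fintype.card κ : ℝ)) := by
  classical
  have hmeas : ∀ i, Measurable fun ω : ι → X => φ (ω i) (ω k) := by
    intro i
    have h : Measurable fun ω : ι → X => (ω i, ω k) :=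
      (measurable_pi_apply i).prodMk (measurable_pi_apply k)
    exact hφ.comp h
  have habs : ∀ i j (ω : ι → X), |φ (ω i) (ω k) * φ (ω j) (ω k)| ≤ 1 := by
    intro i j ω
    rw [abs_mul]
    exact mul_le_one₀ (hφ1 _ _) (abs_nonneg _) (hφ1 _ _)
  have hint : ∀ i j, Integrable (fun ω : ι → X => φ (ω i) (ω k) * φ (ω j) (ω k)) (Measure.pi μ) :=
    fun i j => Integrable.of_bound ((hmeas i).mul (hmeas j)).aestronglyMeasurable 1
      (ae_of_all _ fun ω => habs i j ω)
  -- Only terms with `a = b` or `e a = k` need the trivial bound `1`; the rest vanish on redrawing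
  -- coordinate `e a`. The third indicator is slack, and the three together sum to at most `3 * card
  -- κ`.
  have hterm : ∀ a b : κ, ∫ ω, φ (ω (e a)) (ω k) * φ (ω (e b)) (ω k) ∂(Measure.pi μ) ≤
      (if a = b then 1 else 0) + (if e a = k then 1 else 0) + (if e b = k then (1 : ℝ) else 0) := by
    intro a b
    have hle : ∫ ω, φ (ω (e a)) (ω k) * φ (ω (e b)) (ω k) ∂(Measure.pi μ) ≤ 1 := by
      calc _ ≤ ∫ _ω, (1 : ℝ) ∂(Measure.pi μ) :=
            integral_mono (hint _ _) (integrable_const _) fun ω => (abs_le.1 (habs _ _ ω)).2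
        _ = 1 := by simp
    by_cases hab : a = b
    · rw [if_pos hab]
      split_ifs <;> linarith
    by_cases ha : e a = k
    · rw [if_pos ha]
      split_ifs <;> linarith
    have h0 : ∫ ω, φ (ω (e a)) (ω k) * φ (ω (e b)) (ω k) ∂(Measure.pi μ) = 0 := by
      refine integral_pi_eq_zero_of_update μ (i := e a) (hint _ _) fun ω => ?_
      simp only [Function.update_self, Function.update_of_ne (Ne.symm ha),
        Function.update_of_ne (he.ne (Ne.symm hab))]
      rw [integral_mul_const, heP, hφ0, zero_mul]
    rw [h0]
    split_ifs <;> norm_num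
  have hexp : ∀ ω : ι → X, ((1 / (Fintype.card κ : ℝ)) * ∑ a, φ (ω (e a)) (ω k)) ^ 2 =
      (1 / (Fintype.card κ : ℝ)) ^ 2 * ∑ a, ∑ b, φ (ω (e a)) (ω k) * φ (ω (e b)) (ω k) := by
    intro ω
    rw [mul_pow, sq (∑ a, φ (ω (e a)) (ω k)), Finset.sum_mul_sum]
  simp only [hexp]
  rw [integral_const_mul, integral_finsetSum _ fun a _ => integrable_finsetSum _ fun b _ => hint _ _]
  simp only [integral_finsetSum _ fun b _ => hint _ _]
  have hone : ∑ a : κ, (if e a = k then (1 : ℝ) else 0) ≤ 1 := by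
    rw [Finset.sum_ite, Finset.sum_const_zero, add_zero, Finset.sum_const, nsmul_eq_mul, mul_one]
    have : (Finset.univ.filter fun a => e a = k).card ≤ 1 :=
      Finset.card_le_one.2 fun a ha b hb => he (by
        rw [(Finset.mem_filter.1 ha).2, (Finset.mem_filter.1 hb).2])
    exact_mod_cast this
  have hsum : ∑ a, ∑ b, ∫ ω, φ (ω (e a)) (ω k) * φ (ω (e b)) (ω k) ∂(Measure.pi μ) ≤
      3 * (Fintype.card κ : ℝ) := by
    refine (Finset.sum_le_sum fun a _ => Finset.sum_le_sum fun b _ => hterm a b).trans ?_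
    simp only [Finset.sum_add_distrib, Finset.sum_ite_eq, Finset.mem_univ, if_true,
      Finset.sum_const, Finset.card_univ, nsmul_eq_mul, mul_one, ← Finset.mul_sum]
    have := mul_le_mul_of_nonneg_left hone (Nat.cast_nonneg (α := ℝ) (Fintype.card κ))
    linarith
  refine (mul_le_mul_of_nonneg_left hsum (by positivity)).trans (le_of_eq ?_)
  rcases Nat.eq_zero_or_pos (Fintype.card κ) with h | h
  · simp [h]
  · have : (0 : ℝ) < Fintype.card κ := by exact_mod_cast h
    field_simp

/-! ### Distribution functions of projections -/

section ProjCDF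

variable {d : ℕ} (P : Measure (E d))

theorem projCDF_nonneg (β : Metric.sphere (0 : E d) 1) (t : ℝ) : 0 ≤ projCDF P β t :=
  cdf_nonneg _ _

theorem projCDF_le_one (β : Metric.sphere (0 : E d) 1) (t : ℝ) : projCDF P β t ≤ 1 :=
  cdf_le_one _ _

variable [IsProbabilityMeasure P]

theorem isProbabilityMeasure_projLaw (β : Metric.sphere (0 : E d) 1) :
    IsProbabilityMeasure (projLaw P β) :=
  Measure.isProbabilityMeasure_map (by fun_prop)

theorem projCDF_eq (β : Metric.sphere (0 : E d) 1) (t : ℝ) :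
    projCDF P β t = (P {x | inner ℝ (β : E d) x ≤ t}).toReal := by
  have := isProbabilityMeasure_projLaw P β
  rw [projCDF, cdf_eq_real, measureReal_def, projLaw, Measure.map_apply (by fun_prop)
    measurableSet_Iic]
  rfl

@[fun_prop]
theorem measurable_projCDF {Ω : Type*} [MeasurableSpace Ω] {b : Ω → Metric.sphere (0 : E d) 1}
    {t : Ω → ℝ} (hb : Measurable b) (ht : Measurable t) :
    Measurable fun ω => projCDF P (b ω) (t ω) := by
  set S : Set ((Metric.sphere (0 : E d) 1 × ℝ) × E d) :=
    {p | inner ℝ (p.1.1 : E d) p.2 ≤ p.1.2} with hS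
  have hSm : MeasurableSet S :=
    measurableSet_le (f := fun p : (Metric.sphere (0 : E d) 1 × ℝ) × E d =>
      inner ℝ (p.1.1 : E d) p.2) (g := fun p => p.1.2) (by fun_prop) (by fun_prop)
  have h : (fun ω => projCDF P (b ω) (t ω)) =
      (fun p => (P (Prod.mk p ⁻¹' S)).toReal) ∘ fun ω => (b ω, t ω) := by
    funext ω
    rw [projCDF_eq]
    rfl
  rw [h]
  exact (measurable_measure_prodMk_left hSm).ennreal_toReal.comp (hb.prodMk ht)

theorem measure_inner_eq_zero {β : Metric.sphere (0 : E d) 1} (hβ : Continuous (projCDF P β))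
    (t : ℝ) : P {x | inner ℝ (β : E d) x = t} = 0 := by
  have := isProbabilityMeasure_projLaw P β
  have h1 : projLaw P β {t} = 0 := by
    rw [← measure_cdf (projLaw P β), StieltjesFunction.measure_singleton]
    have : Function.leftLim (cdf (projLaw P β)) t = cdf (projLaw P β) t :=
      (show ContinuousAt (cdf (projLaw P β)) t from hβ.continuousAt).continuousWithinAt.leftLim_eq
    rw [this, sub_self, ENNReal.ofReal_zero]
  rw [projLaw, Measure.map_apply (by fun_prop) (measurableSet_singleton t)] at h1
  exact h1

/-- Continuity rules out an atom of the projection at `t`, so strict and non-strict indicators have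
the same mean. -/
theorem integral_ltInd_sub_projCDF {β : Metric.sphere (0 : E d) 1}
    (hβ : Continuous (projCDF P β)) (t : ℝ) :
    ∫ x, (ltInd (inner ℝ (β : E d) x) t - projCDF P β t) ∂P = 0 := by
  have hm : MeasurableSet {x : E d | inner ℝ (β : E d) x ≤ t} :=
    measurableSet_le (f := fun x : E d => inner ℝ (β : E d) x) (g := fun _ => t)
      (by fun_prop) measurable_const
  have hae : ∀ᵐ x ∂P, ltInd (inner ℝ (β : E d) x) t =
      {x : E d | inner ℝ (β : E d) x ≤ t}.indicator 1 x := by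
    have h0 : ∀ᵐ x ∂P, inner ℝ (β : E d) x ≠ t := by
      rw [ae_iff]
      simp [measure_inner_eq_zero P hβ t]
    filter_upwards [h0] with x hx
    simp only [ltInd, Set.indicator_apply, Set.mem_ofPred_eq, Pi.one_apply]
    exact if_congr ⟨le_of_lt, fun h => lt_of_le_of_ne h hx⟩ rfl rfl
  have hint : Integrable (fun x : E d => ltInd (inner ℝ (β : E d) x) t) P :=
    Integrable.of_bound (Measurable.aestronglyMeasurable (by fun_prop)) 1 (ae_of_all _ fun x => by
      rw [Real.norm_of_nonneg (ltInd_nonneg _ _)]; exact ltInd_le_one _ _)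
  rw [integral_sub hint (integrable_const _), integral_congr_ae hae, integral_indicator_one hm,
    integral_const, probReal_univ, one_smul, projCDF_eq, measureReal_def, sub_self]

-- A point lies in a level set of `inner ℝ β`, and one direction with a continuous distribution
-- function suffices to make that set null.
variable {P} in
theorem measure_singleton_of_continuousProjections (hd : 1 ≤ d) (hP : ContinuousProjections P)
    (x : E d) : P {x} = 0 := by
  have := isProbabilityMeasure_sphereUnif hd
  obtain ⟨β, hβ⟩ := hP.exists
  refine measure_mono_null ?_ (measure_inner_eq_zero P hβ (inner ℝ (β : E d) x))
  rintro _ rfl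
  rfl

end ProjCDF

/-! ### The pooled sample -/

section Pooled

variable {d m n : ℕ} (θ : ℝ) (P Q : Measure (E d))

/-- The marginal laws of the pooled sample. -/
def pooledLaw (m n : ℕ) : Fin m ⊕ Fin n → Measure (E d) := Sum.elim (fun _ => P) (fun _ => Q)

/-- The weights `θ / m` on the first and `(1 - θ) / n` on the second sample. -/
def pooledWeight (m n : ℕ) : Fin m ⊕ Fin n → ℝ :=
  Sum.elim (fun _ => θ / m) (fun _ => (1 - θ) / n)

/-- The squared difference of the distribution functions of the projections. -/
def sqGap (β : Metric.sphere (0 : E d) 1) (t : ℝ) : ℝ := (projCDF P β t - projCDF Q β t) ^ 2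

/-- The squared difference of the distribution functions at the projections of a point, averaged
over all directions. -/
def meanSqGap (x : E d) : ℝ :=
  ∫ β : Metric.sphere (0 : E d) 1, sqGap P Q β (inner ℝ (β : E d) x) ∂(sphereUnif d)

/-- The squared estimation errors of the two empirical distribution functions at the projection of
the `k`-th pooled point. -/
def sqError (β : Metric.sphere (0 : E d) 1) (ω : Fin m ⊕ Fin n → E d) (k : Fin m ⊕ Fin n) : ℝ :=
  (ecdf (fun i => inner ℝ (β : E d) (ω (Sum.inl i))) (inner ℝ (β : E d) (ω k)) -
      projCDF P β (inner ℝ (β : E d) (ω k))) ^ 2 +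
    (ecdf (fun j => inner ℝ (β : E d) (ω (Sum.inr j))) (inner ℝ (β : E d) (ω k)) -
      projCDF Q β (inner ℝ (β : E d) (ω k))) ^ 2

theorem sqGap_nonneg (β : Metric.sphere (0 : E d) 1) (t : ℝ) : 0 ≤ sqGap P Q β t := sq_nonneg _

theorem sqGap_le_one (β : Metric.sphere (0 : E d) 1) (t : ℝ) : sqGap P Q β t ≤ 1 :=
  sq_sub_le_one (projCDF_nonneg P _ _) (projCDF_le_one P _ _) (projCDF_nonneg Q _ _)
    (projCDF_le_one Q _ _)

theorem sqError_nonneg (β : Metric.sphere (0 : E d) 1) (ω : Fin m ⊕ Fin n → E d)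
    (k : Fin m ⊕ Fin n) : 0 ≤ sqError P Q β ω k := add_nonneg (sq_nonneg _) (sq_nonneg _)

theorem meanSqGap_nonneg (x : E d) : 0 ≤ meanSqGap P Q x :=
  integral_nonneg fun _ => sqGap_nonneg P Q _ _

theorem sum_pooledWeight (hm : m ≠ 0) (hn : n ≠ 0) : ∑ k, pooledWeight θ m n k = 1 := by
  have hm0 : (m : ℝ) ≠ 0 := by exact_mod_cast hm
  have hn0 : (n : ℝ) ≠ 0 := by exact_mod_cast hn
  rw [Fintype.sum_sum_type]
  simp only [pooledWeight, Sum.elim_inl, Sum.elim_inr, Finset.sum_const, Finset.card_univ,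
    Fintype.card_fin, nsmul_eq_mul]
  field_simp
  ring

theorem pooledWeight_nonneg {θ : ℝ} (hθ : 0 ≤ θ) (hθ' : θ ≤ 1) (k : Fin m ⊕ Fin n) :
    0 ≤ pooledWeight θ m n k := by
  have := sub_nonneg.2 hθ'
  rcases k with k | k <;> simp only [pooledWeight, Sum.elim_inl, Sum.elim_inr] <;> positivity

theorem pooledWeight_le {θ : ℝ} (hθ : 0 ≤ θ) (hθ' : θ ≤ 1) (k : Fin m ⊕ Fin n) :
    pooledWeight θ m n k ≤ 1 / m + 1 / n := by
  have h1 : (0 : ℝ) ≤ 1 / m := by positivity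
  have h2 : (0 : ℝ) ≤ 1 / n := by positivity
  rcases k with k | k <;> simp only [pooledWeight, Sum.elim_inl, Sum.elim_inr]
  · have : θ / m ≤ 1 / m := div_le_div_of_nonneg_right hθ' (by positivity)
    linarith
  · have : (1 - θ) / n ≤ 1 / n := div_le_div_of_nonneg_right (by linarith) (by positivity)
    linarith

/-- Write `f - g = (a - b) + ((b - g) - (a - f))` and use `(u + v)² ≤ 2u² + 2v²` twice. -/
theorem half_sq_sub_le (a b f g : ℝ) :
    1 / 2 * (f - g) ^ 2 - 2 * ((a - f) ^ 2 + (b - g) ^ 2) ≤ (a - b) ^ 2 := by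
  nlinarith [sq_nonneg (2 * (a - b) - (f - g)), sq_nonneg ((a - f) + (b - g)),
    sq_nonneg (f - g - 2 * (a - b))]

theorem weighted_sqGap_le_vStat {θ : ℝ} (hθ : 0 ≤ θ) (hθ' : θ ≤ 1) (β : Metric.sphere (0 : E d) 1)
    (ω : Fin m ⊕ Fin n → E d) :
    1 / 2 * (∑ k, pooledWeight θ m n k * sqGap P Q β (inner ℝ (β : E d) (ω k))) -
        2 * ∑ k, pooledWeight θ m n k * sqError P Q β ω k ≤
      θ * vStat (fun i => inner ℝ (β : E d) (ω (Sum.inl i)))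
          (fun j => inner ℝ (β : E d) (ω (Sum.inr j))) +
        (1 - θ) * vStat (fun j => inner ℝ (β : E d) (ω (Sum.inr j)))
          (fun i => inner ℝ (β : E d) (ω (Sum.inl i))) := by
  set F := ecdf (fun i => inner ℝ (β : E d) (ω (Sum.inl i))) with hF
  set G := ecdf (fun j => inner ℝ (β : E d) (ω (Sum.inr j))) with hG
  have hrhs : θ * vStat (fun i => inner ℝ (β : E d) (ω (Sum.inl i)))
          (fun j => inner ℝ (β : E d) (ω (Sum.inr j))) +
        (1 - θ) * vStat (fun j => inner ℝ (β : E d) (ω (Sum.inr j)))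
          (fun i => inner ℝ (β : E d) (ω (Sum.inl i))) =
      ∑ k, pooledWeight θ m n k *
        (F (inner ℝ (β : E d) (ω k)) - G (inner ℝ (β : E d) (ω k))) ^ 2 := by
    rw [Fintype.sum_sum_type]
    simp only [pooledWeight, Sum.elim_inl, Sum.elim_inr, ← Finset.mul_sum]
    unfold vStat
    rw [← hF, ← hG]
    have hsymm : ∀ j, (G (inner ℝ (β : E d) (ω (Sum.inr j))) -
        F (inner ℝ (β : E d) (ω (Sum.inr j)))) ^ 2 = (F (inner ℝ (β : E d) (ω (Sum.inr j))) -
        G (inner ℝ (β : E d) (ω (Sum.inr j)))) ^ 2 := fun j => by ring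
    simp only [hsymm]
    ring
  rw [hrhs, Finset.mul_sum, Finset.mul_sum, ← Finset.sum_sub_distrib]
  refine Finset.sum_le_sum fun k _ => ?_
  have h := mul_le_mul_of_nonneg_left (half_sq_sub_le (F (inner ℝ (β : E d) (ω k)))
    (G (inner ℝ (β : E d) (ω k))) (projCDF P β (inner ℝ (β : E d) (ω k)))
    (projCDF Q β (inner ℝ (β : E d) (ω k)))) (pooledWeight_nonneg hθ hθ' k)
  refine le_trans (le_of_eq ?_) h
  simp only [sqGap, sqError, ← hF, ← hG]
  ring

variable [IsProbabilityMeasure P] [IsProbabilityMeasure Q]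

instance (k : Fin m ⊕ Fin n) : IsProbabilityMeasure (pooledLaw P Q m n k) := by
  rcases k with k | k <;> simp only [pooledLaw, Sum.elim_inl, Sum.elim_inr] <;> infer_instance

@[fun_prop]
theorem measurable_sqGap {Ω : Type*} [MeasurableSpace Ω] {b : Ω → Metric.sphere (0 : E d) 1}
    {t : Ω → ℝ} (hb : Measurable b) (ht : Measurable t) :
    Measurable fun ω => sqGap P Q (b ω) (t ω) := by
  unfold sqGap
  fun_prop

theorem integrable_sqGap {Ω : Type*} [MeasurableSpace Ω] (ν : Measure Ω) [IsFiniteMeasure ν]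
    {b : Ω → Metric.sphere (0 : E d) 1} {t : Ω → ℝ} (hb : Measurable b) (ht : Measurable t) :
    Integrable (fun ω => sqGap P Q (b ω) (t ω)) ν :=
  Integrable.of_bound (Measurable.aestronglyMeasurable (by fun_prop)) 1 (ae_of_all _ fun ω => by
    rw [Real.norm_of_nonneg (sqGap_nonneg P Q _ _)]; exact sqGap_le_one P Q _ _)

theorem integrable_sqError {Ω : Type*} [MeasurableSpace Ω] (ν : Measure Ω) [IsFiniteMeasure ν]
    {b : Ω → Metric.sphere (0 : E d) 1} {ω : Ω → Fin m ⊕ Fin n → E d} (hb : Measurable b)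
    (hω : Measurable ω) (k : Fin m ⊕ Fin n) :
    Integrable (fun u => sqError P Q (b u) (ω u) k) ν := by
  refine Integrable.of_bound (Measurable.aestronglyMeasurable ?_) 2 (ae_of_all _ fun u => ?_)
  · unfold sqError
    fun_prop
  · rw [Real.norm_of_nonneg (sqError_nonneg P Q _ _ _)]
    have h1 := fun t => sq_sub_le_one
      (ecdf_nonneg (fun i => inner ℝ (b u : E d) (ω u (Sum.inl i))) t) (ecdf_le_one _ _)
      (projCDF_nonneg P (b u) t) (projCDF_le_one P _ _)
    have h2 := fun t => sq_sub_le_one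
      (ecdf_nonneg (fun i => inner ℝ (b u : E d) (ω u (Sum.inr i))) t) (ecdf_le_one _ _)
      (projCDF_nonneg Q (b u) t) (projCDF_le_one Q _ _)
    unfold sqError
    linarith [h1 (inner ℝ (b u : E d) (ω u k)), h2 (inner ℝ (b u : E d) (ω u k))]

theorem measurable_meanSqGap (hd : 1 ≤ d) : Measurable (meanSqGap P Q) := by
  have := isProbabilityMeasure_sphereUnif hd
  have h : StronglyMeasurable (Function.uncurry fun (x : E d) (β : Metric.sphere (0 : E d) 1) =>
      sqGap P Q β (inner ℝ (β : E d) x)) := by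
    refine Measurable.stronglyMeasurable ?_
    unfold Function.uncurry
    fun_prop
  exact (StronglyMeasurable.integral_prod_right (ν := sphereUnif d) h).measurable

theorem meanSqGap_le_one (hd : 1 ≤ d) (x : E d) : meanSqGap P Q x ≤ 1 := by
  have := isProbabilityMeasure_sphereUnif hd
  calc meanSqGap P Q x ≤ ∫ _β, (1 : ℝ) ∂(sphereUnif d) :=
        integral_mono (integrable_sqGap P Q _ measurable_id (by fun_prop)) (integrable_const _)
          fun _ => sqGap_le_one P Q _ _
    _ = 1 := by simp

theorem memLp_meanSqGap (hd : 1 ≤ d) (ν : Measure (E d)) [IsFiniteMeasure ν] :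
    MemLp (meanSqGap P Q) 2 ν :=
  MemLp.of_bound (measurable_meanSqGap P Q hd).aestronglyMeasurable 1 (ae_of_all _ fun x => by
    rw [Real.norm_of_nonneg (meanSqGap_nonneg P Q _)]; exact meanSqGap_le_one P Q hd x)

theorem integrable_meanSqGap (hd : 1 ≤ d) (ν : Measure (E d)) [IsFiniteMeasure ν] :
    Integrable (meanSqGap P Q) ν :=
  (memLp_meanSqGap P Q hd ν).integrable (by norm_num)

/-- Fubini exchanges direction and sample point, expressing the distance by means of a single
function on `E d`, to which laws of independent points apply. -/
theorem sqDist_eq (hd : 1 ≤ d) (hθ : 0 ≤ θ) (hθ' : θ ≤ 1) :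
    sqDist θ P Q = θ * ∫ x, meanSqGap P Q x ∂P + (1 - θ) * ∫ x, meanSqGap P Q x ∂Q := by
  have := isProbabilityMeasure_sphereUnif hd
  have hsw : ∀ (ν : Measure (E d)) [IsProbabilityMeasure ν], ∫ x, meanSqGap P Q x ∂ν =
      ∫ β : Metric.sphere (0 : E d) 1, ∫ x, sqGap P Q β (inner ℝ (β : E d) x) ∂ν ∂(sphereUnif d) := by
    intro ν _
    have h : Integrable (Function.uncurry fun (x : E d) (β : Metric.sphere (0 : E d) 1) =>
        sqGap P Q β (inner ℝ (β : E d) x)) (ν.prod (sphereUnif d)) :=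
      integrable_sqGap P Q _ measurable_snd (by fun_prop)
    exact integral_integral_swap h
  have hi : ∀ (ν : Measure (E d)) [IsProbabilityMeasure ν],
      Integrable (fun β : Metric.sphere (0 : E d) 1 =>
        ∫ x, sqGap P Q β (inner ℝ (β : E d) x) ∂ν) (sphereUnif d) := by
    intro ν _
    have h : Integrable (fun p : Metric.sphere (0 : E d) 1 × E d =>
        sqGap P Q p.1 (inner ℝ (p.1 : E d) p.2)) ((sphereUnif d).prod ν) :=
      integrable_sqGap P Q _ measurable_fst (by fun_prop)
    exact h.integral_prod_left
  rw [hsw P, hsw Q, ← integral_const_mul, ← integral_const_mul,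
    ← integral_add ((hi P).const_mul _) ((hi Q).const_mul _), sqDist]
  refine integral_congr_ae (ae_of_all _ fun β => ?_)
  have := isProbabilityMeasure_projLaw P β
  have := isProbabilityMeasure_projLaw Q β
  have hmap : ∀ (ν : Measure (E d)) [IsProbabilityMeasure ν],
      ∫ t, sqGap P Q β t ∂(projLaw ν β) = ∫ x, sqGap P Q β (inner ℝ (β : E d) x) ∂ν := fun ν _ =>
    integral_map (by fun_prop) (Measurable.aestronglyMeasurable (by fun_prop))
  have hint : ∀ (ν : Measure ℝ) [IsFiniteMeasure ν], Integrable (fun t => sqGap P Q β t) ν :=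
    fun ν _ => integrable_sqGap P Q ν measurable_const measurable_id
  change ∫ t, sqGap P Q β t ∂(mixLaw θ P Q β) = _
  rw [mixLaw, integral_add_measure ((hint _).smul_measure ENNReal.ofReal_ne_top)
    ((hint _).smul_measure ENNReal.ofReal_ne_top), integral_smul_measure, integral_smul_measure,
    hmap, hmap, ENNReal.toReal_ofReal hθ, ENNReal.toReal_ofReal (sub_nonneg.2 hθ')]
  rfl

theorem sum_pooledWeight_mul_integral (hd : 1 ≤ d) (hm : m ≠ 0) (hn : n ≠ 0) (hθ : 0 ≤ θ)
    (hθ' : θ ≤ 1) :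
    ∑ k, pooledWeight θ m n k * ∫ x, meanSqGap P Q x ∂(pooledLaw P Q m n k) = sqDist θ P Q := by
  have hm0 : (m : ℝ) ≠ 0 := by exact_mod_cast hm
  have hn0 : (n : ℝ) ≠ 0 := by exact_mod_cast hn
  rw [sqDist_eq θ P Q hd hθ hθ', Fintype.sum_sum_type]
  simp only [pooledWeight, pooledLaw, Sum.elim_inl, Sum.elim_inr, Finset.sum_const,
    Finset.card_univ, Fintype.card_fin, nsmul_eq_mul]
  field_simp

/-- The weighted empirical mean of `meanSqGap` has expectation `sqDist`. -/
theorem integral_weighted_meanSqGap (hd : 1 ≤ d) (hm : m ≠ 0) (hn : n ≠ 0) (hθ : 0 ≤ θ)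
    (hθ' : θ ≤ 1) :
    ∫ ω, ∑ k, pooledWeight θ m n k * meanSqGap P Q (ω k) ∂(Measure.pi (pooledLaw P Q m n)) =
      sqDist θ P Q := by
  rw [← sum_pooledWeight_mul_integral θ P Q hd hm hn hθ hθ', integral_finsetSum]
  · refine Finset.sum_congr rfl fun k _ => ?_
    rw [integral_const_mul]
    congr 1
    exact integral_comp_eval (measurable_meanSqGap P Q hd).aestronglyMeasurable
  · intro k _
    refine Integrable.const_mul ?_ _
    exact (measurePreserving_eval (pooledLaw P Q m n) k).integrable_comp_of_integrable
      (integrable_meanSqGap P Q hd _)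

theorem memLp_weighted_meanSqGap (hd : 1 ≤ d) :
    MemLp (fun ω : Fin m ⊕ Fin n → E d => ∑ k, pooledWeight θ m n k * meanSqGap P Q (ω k)) 2
      (Measure.pi (pooledLaw P Q m n)) :=
  memLp_finsetSum _ fun k _ => ((memLp_meanSqGap P Q hd _).comp_measurePreserving
    (measurePreserving_eval (pooledLaw P Q m n) k)).const_mul _

/-- The summands are independent, and values in `[0, 1]` have variance at most their mean; one
factor of each squared weight is bounded by `1/m + 1/n`. Proportionality to `sqDist` is essential:
Chebyshev then loses `r / W` rather than `r / W²`. -/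
theorem variance_weighted_meanSqGap_le (hd : 1 ≤ d) (hm : m ≠ 0) (hn : n ≠ 0) (hθ : 0 ≤ θ)
    (hθ' : θ ≤ 1) :
    variance (fun ω : Fin m ⊕ Fin n → E d => ∑ k, pooledWeight θ m n k * meanSqGap P Q (ω k))
      (Measure.pi (pooledLaw P Q m n)) ≤ (1 / m + 1 / n) * sqDist θ P Q := by
  have h := variance_sum_pi (μ := pooledLaw P Q m n)
    (X := fun k x => pooledWeight θ m n k * meanSqGap P Q x)
    (fun k => (memLp_meanSqGap P Q hd _).const_mul _)
  have hfun : (∑ k, fun ω : Fin m ⊕ Fin n → E d => pooledWeight θ m n k * meanSqGap P Q (ω k)) =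
      fun ω => ∑ k, pooledWeight θ m n k * meanSqGap P Q (ω k) := by
    ext ω
    simp
  rw [hfun] at h
  rw [h, ← sum_pooledWeight_mul_integral θ P Q hd hm hn hθ hθ', Finset.mul_sum]
  refine Finset.sum_le_sum fun k _ => ?_
  rw [variance_const_mul]
  have h1 : variance (meanSqGap P Q) (pooledLaw P Q m n k) ≤
      ∫ x, meanSqGap P Q x ∂(pooledLaw P Q m n k) := by
    refine (variance_le_expectation_sq (measurable_meanSqGap P Q hd).aestronglyMeasurable).trans ?_
    refine integral_mono (memLp_meanSqGap P Q hd _).integrable_sq (integrable_meanSqGap P Q hd _) ?_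
    intro x
    have h0 := meanSqGap_nonneg P Q x
    have h1 := meanSqGap_le_one P Q hd x
    simp only [Pi.pow_apply]
    nlinarith
  have h0 : 0 ≤ ∫ x, meanSqGap P Q x ∂(pooledLaw P Q m n k) :=
    integral_nonneg fun x => meanSqGap_nonneg P Q x
  have hw := pooledWeight_nonneg hθ hθ' k
  calc pooledWeight θ m n k ^ 2 * variance (meanSqGap P Q) (pooledLaw P Q m n k)
      ≤ pooledWeight θ m n k ^ 2 * ∫ x, meanSqGap P Q x ∂(pooledLaw P Q m n k) :=
        mul_le_mul_of_nonneg_left h1 (sq_nonneg _)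
    _ = pooledWeight θ m n k *
        (pooledWeight θ m n k * ∫ x, meanSqGap P Q x ∂(pooledLaw P Q m n k)) := by ring
    _ ≤ _ := mul_le_mul_of_nonneg_right (pooledWeight_le hθ hθ' k) (mul_nonneg hw h0)

/-! ### Estimation errors -/

variable {P Q} in
theorem integral_sqError_le {β : Metric.sphere (0 : E d) 1} (hm : m ≠ 0) (hn : n ≠ 0)
    (hP : Continuous (projCDF P β)) (hQ : Continuous (projCDF Q β)) (k : Fin m ⊕ Fin n) :
    ∫ ω, sqError P Q β ω k ∂(Measure.pi (pooledLaw P Q m n)) ≤ 3 * (1 / m + 1 / n) := by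
  have hgen : ∀ (R : Measure (E d)) [IsProbabilityMeasure R], Continuous (projCDF R β) →
      ∀ {p : ℕ} (hp : p ≠ 0) (e : Fin p → Fin m ⊕ Fin n), Function.Injective e →
      (∀ a, pooledLaw P Q m n (e a) = R) →
      ∫ ω, (ecdf (fun i => inner ℝ (β : E d) (ω (e i))) (inner ℝ (β : E d) (ω k)) -
        projCDF R β (inner ℝ (β : E d) (ω k))) ^ 2 ∂(Measure.pi (pooledLaw P Q m n)) ≤
        3 * (1 / p) := by
    intro R _ hR p hp e he heR
    have hp0 : (p : ℝ) ≠ 0 := by exact_mod_cast hp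
    have h := integral_sq_average_le (pooledLaw P Q m n) he heR
      (φ := fun x y => ltInd (inner ℝ (β : E d) x) (inner ℝ (β : E d) y) -
        projCDF R β (inner ℝ (β : E d) y))
      (by unfold Function.uncurry; fun_prop)
      (fun x y => by
        rw [← sq_le_one_iff_abs_le_one]
        exact sq_sub_le_one (ltInd_nonneg _ _) (ltInd_le_one _ _) (projCDF_nonneg R _ _)
          (projCDF_le_one R _ _))
      (fun y => integral_ltInd_sub_projCDF R hR _) k
    rw [Fintype.card_fin] at h
    refine le_trans (le_of_eq ?_) h
    refine integral_congr_ae (ae_of_all _ fun ω => ?_)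
    simp only [ecdf, Finset.sum_sub_distrib, Finset.sum_const, Finset.card_univ, Fintype.card_fin,
      nsmul_eq_mul]
    congr 1
    field_simp
  have h1 := hgen P hP hm Sum.inl Sum.inl_injective fun _ => rfl
  have h2 := hgen Q hQ hn Sum.inr Sum.inr_injective fun _ => rfl
  unfold sqError
  have hint : ∀ (R : Measure (E d)) [IsProbabilityMeasure R] {p : ℕ} (e : Fin p → Fin m ⊕ Fin n),
      Integrable (fun ω : Fin m ⊕ Fin n → E d =>
        (ecdf (fun i => inner ℝ (β : E d) (ω (e i))) (inner ℝ (β : E d) (ω k)) -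
        projCDF R β (inner ℝ (β : E d) (ω k))) ^ 2) (Measure.pi (pooledLaw P Q m n)) := by
    intro R _ p e
    refine Integrable.of_bound (Measurable.aestronglyMeasurable (by fun_prop)) 1
      (ae_of_all _ fun ω => ?_)
    rw [Real.norm_of_nonneg (sq_nonneg _)]
    exact sq_sub_le_one (ecdf_nonneg _ _) (ecdf_le_one _ _) (projCDF_nonneg R _ _)
      (projCDF_le_one R _ _)
  rw [integral_add (hint P Sum.inl) (hint Q Sum.inr)]
  linarith

-- Exchanging the integrals fixes a direction first, so that almost every direction has continuous
-- projections and `integral_sqError_le` applies.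
variable {P Q} in
theorem integral_weighted_sqError_le (hd : 1 ≤ d) (hm : m ≠ 0) (hn : n ≠ 0) (hθ : 0 ≤ θ)
    (hθ' : θ ≤ 1) (hP : ContinuousProjections P) (hQ : ContinuousProjections Q) :
    ∫ ω, ∫ β, ∑ k, pooledWeight θ m n k * sqError P Q β ω k ∂(sphereUnif d)
      ∂(Measure.pi (pooledLaw P Q m n)) ≤ 3 * (1 / m + 1 / n) := by
  have := isProbabilityMeasure_sphereUnif hd
  have hint : ∀ {Ω : Type} [MeasurableSpace Ω] (ν : Measure Ω) [IsFiniteMeasure ν]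
      {b : Ω → Metric.sphere (0 : E d) 1} {ω : Ω → Fin m ⊕ Fin n → E d}, Measurable b →
      Measurable ω →
      Integrable (fun u => ∑ k, pooledWeight θ m n k * sqError P Q (b u) (ω u) k) ν :=
    fun ν _ _ _ hb hω => integrable_finsetSum _ fun k _ =>
      (integrable_sqError P Q ν hb hω k).const_mul _
  rw [integral_integral_swap (hint ((Measure.pi (pooledLaw P Q m n)).prod (sphereUnif d))
    measurable_snd measurable_fst)]
  have hae : ∀ᵐ β ∂(sphereUnif d), ∫ ω, ∑ k, pooledWeight θ m n k * sqError P Q β ω k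
      ∂(Measure.pi (pooledLaw P Q m n)) ≤ 3 * (1 / m + 1 / n) := by
    filter_upwards [hP, hQ] with β h1 h2
    have hk : ∀ k, Integrable (fun ω => sqError P Q β ω k) (Measure.pi (pooledLaw P Q m n)) :=
      fun k => integrable_sqError P Q _ measurable_const measurable_id k
    rw [integral_finsetSum _ fun k _ => (hk k).const_mul _]
    calc ∑ k, ∫ ω, pooledWeight θ m n k * sqError P Q β ω k ∂(Measure.pi (pooledLaw P Q m n))
        ≤ ∑ k, pooledWeight θ m n k * (3 * (1 / m + 1 / n)) := by
          refine Finset.sum_le_sum fun k _ => ?_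
          rw [integral_const_mul]
          exact mul_le_mul_of_nonneg_left (integral_sqError_le hm hn h1 h2 k)
            (pooledWeight_nonneg hθ hθ' k)
      _ = 3 * (1 / m + 1 / n) := by
          rw [← Finset.sum_mul, sum_pooledWeight θ hm hn, one_mul]
  calc _ ≤ ∫ _β, 3 * (1 / (m : ℝ) + 1 / n) ∂(sphereUnif d) :=
        integral_mono_ae (Integrable.integral_prod_left
          (hint ((sphereUnif d).prod (Measure.pi (pooledLaw P Q m n)))
            measurable_fst measurable_snd)) (integrable_const _) hae
    _ = _ := by simp

theorem weighted_meanSqGap_le_integral_vStat (hd : 1 ≤ d) {θ : ℝ} (hθ : 0 ≤ θ) (hθ' : θ ≤ 1)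
    (ω : Fin m ⊕ Fin n → E d) :
    1 / 2 * (∑ k, pooledWeight θ m n k * meanSqGap P Q (ω k)) -
        2 * ∫ β, ∑ k, pooledWeight θ m n k * sqError P Q β ω k ∂(sphereUnif d) ≤
      ∫ β : Metric.sphere (0 : E d) 1, (θ * vStat (fun i => inner ℝ (β : E d) (ω (Sum.inl i)))
          (fun j => inner ℝ (β : E d) (ω (Sum.inr j))) +
        (1 - θ) * vStat (fun j => inner ℝ (β : E d) (ω (Sum.inr j)))
          (fun i => inner ℝ (β : E d) (ω (Sum.inl i)))) ∂(sphereUnif d) := by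
  have := isProbabilityMeasure_sphereUnif hd
  have hgap : ∀ k, Integrable (fun β : Metric.sphere (0 : E d) 1 =>
      sqGap P Q β (inner ℝ (β : E d) (ω k))) (sphereUnif d) := fun k =>
    integrable_sqGap P Q _ measurable_id (by fun_prop)
  have h1 : Integrable (fun β : Metric.sphere (0 : E d) 1 => ∑ k, pooledWeight θ m n k *
      sqGap P Q β (inner ℝ (β : E d) (ω k))) (sphereUnif d) :=
    integrable_finsetSum _ fun k _ => (hgap k).const_mul _
  have h2 : Integrable (fun β : Metric.sphere (0 : E d) 1 => ∑ k, pooledWeight θ m n k *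
      sqError P Q β ω k) (sphereUnif d) :=
    integrable_finsetSum _ fun k _ =>
      (integrable_sqError P Q _ measurable_id measurable_const k).const_mul _
  have h3 : ∑ k, pooledWeight θ m n k * meanSqGap P Q (ω k) =
      ∫ β : Metric.sphere (0 : E d) 1, ∑ k, pooledWeight θ m n k *
        sqGap P Q β (inner ℝ (β : E d) (ω k)) ∂(sphereUnif d) := by
    rw [integral_finsetSum _ fun k _ => (hgap k).const_mul _]
    simp only [integral_const_mul, meanSqGap]
  rw [h3, ← integral_const_mul, ← integral_const_mul,
    ← integral_sub (h1.const_mul _) (h2.const_mul _)]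
  exact integral_mono ((h1.const_mul _).sub (h2.const_mul _))
    (((integrable_vStat hd _ _).const_mul _).add ((integrable_vStat hd _ _).const_mul _))
    fun β => weighted_sqGap_le_vStat P Q hθ hθ' β ω

end Pooled

/-! ### The type II error -/

theorem sampleLaw_preimage {d : ℕ} (m n : ℕ) (P Q : ProbabilityMeasure (E d))
    (A : Set (Fin m ⊕ Fin n → E d)) :
    sampleLaw m n P Q {s | Sum.elim s.1 s.2 ∈ A} =
      Measure.pi (pooledLaw (P : Measure (E d)) (Q : Measure (E d)) m n) A := by
  have h := measurePreserving_sumPiEquivProdPi_symm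
    (pooledLaw (P : Measure (E d)) (Q : Measure (E d)) m n)
  rw [← h.measure_preimage_equiv A]
  rw [sampleLaw]
  rfl

theorem append_injective {m n : ℕ} {X : Type*} {s : (Fin m → X) × (Fin n → X)}
    (h : Function.Injective (Sum.elim s.1 s.2)) : Function.Injective (Fin.append s.1 s.2) := by
  have : Fin.append s.1 s.2 = Sum.elim s.1 s.2 ∘ finSumFinEquiv.symm := by
    ext k
    refine Fin.addCases (fun i => ?_) (fun j => ?_) k <;> simp
  rw [this]
  exact h.comp finSumFinEquiv.symm.injective

/-- Acceptance is confined to three events: a large deviation of `T`, a large `R`, and ties in the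
pooled sample. Their probabilities are at most `4r / W`, `48r / W` and `0`. -/
theorem typeIIError_le {d m n : ℕ} (hd : 1 ≤ d) (hm : 2 ≤ m) (hn : 2 ≤ n) {α θ : ℝ} (hα : 0 < α)
    (hα' : α < 1) (hθ : 0 ≤ θ) (hθ' : θ ≤ 1) (P Q : ProbabilityMeasure (E d))
    (hP : ContinuousProjections (P : Measure (E d))) (hQ : ContinuousProjections (Q : Measure (E d)))
    {W : ℝ} (hW : sqDist θ (P : Measure (E d)) Q = W) (hW0 : 0 < W)
    (hsep : 32 / α * (1 / m + 1 / n) ≤ W) :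
    typeIIError α m n P Q ≤ ENNReal.ofReal (52 * (1 / m + 1 / n) / W) := by
  have hm0 : m ≠ 0 := by omega
  have hn0 : n ≠ 0 := by omega
  set r : ℝ := 1 / m + 1 / n with hr
  have hr0 : 0 ≤ r := by positivity
  set μ := Measure.pi (pooledLaw (P : Measure (E d)) (Q : Measure (E d)) m n) with hμ
  set T : (Fin m ⊕ Fin n → E d) → ℝ := fun ω =>
    ∑ k, pooledWeight θ m n k * meanSqGap (P : Measure (E d)) Q (ω k) with hT
  set R : (Fin m ⊕ Fin n → E d) → ℝ := fun ω =>
    ∫ β, ∑ k, pooledWeight θ m n k * sqError (P : Measure (E d)) Q β ω k ∂(sphereUnif d) with hR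
  have hET : ∫ ω, T ω ∂μ = W := by
    rw [← hW]
    exact integral_weighted_meanSqGap θ (P : Measure (E d)) Q hd hm0 hn0 hθ hθ'
  have hA : μ {ω | W / 2 ≤ |T ω - W|} ≤ ENNReal.ofReal (4 * r / W) := by
    have h := meas_ge_le_variance_div_sq
      (memLp_weighted_meanSqGap θ (P : Measure (E d)) Q (m := m) (n := n) hd) (half_pos hW0)
    rw [← hμ] at h
    change μ {ω | W / 2 ≤ |T ω - ∫ ω, T ω ∂μ|} ≤ ENNReal.ofReal (variance T μ / (W / 2) ^ 2) at h
    rw [hET] at h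
    refine h.trans (ENNReal.ofReal_le_ofReal ?_)
    have hv : variance T μ ≤ r * W := by
      rw [← hW]
      exact variance_weighted_meanSqGap_le θ (P : Measure (E d)) Q hd hm0 hn0 hθ hθ'
    calc variance T μ / (W / 2) ^ 2 ≤ r * W / (W / 2) ^ 2 :=
          div_le_div_of_nonneg_right hv (by positivity)
      _ = 4 * r / W := by field_simp; ring
  have hRint : Integrable R μ := by
    have := isProbabilityMeasure_sphereUnif hd
    have h : Integrable (fun p : (Fin m ⊕ Fin n → E d) × Metric.sphere (0 : E d) 1 =>
        ∑ k, pooledWeight θ m n k * sqError (P : Measure (E d)) Q p.2 p.1 k)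
        (μ.prod (sphereUnif d)) :=
      integrable_finsetSum _ fun k _ =>
        (integrable_sqError (P : Measure (E d)) Q _ measurable_snd measurable_fst k).const_mul _
    exact h.integral_prod_left
  have hB : μ {ω | W / 16 ≤ R ω} ≤ ENNReal.ofReal (48 * r / W) := by
    have h := mul_meas_ge_le_integral_of_nonneg (μ := μ) (f := R) (ae_of_all _ fun ω =>
      integral_nonneg fun β => Finset.sum_nonneg fun k _ =>
        mul_nonneg (pooledWeight_nonneg hθ hθ' k) (sqError_nonneg _ _ _ _ _)) hRint (W / 16)
    have h2 : ∫ ω, R ω ∂μ ≤ 3 * r := integral_weighted_sqError_le θ hd hm0 hn0 hθ hθ' hP hQ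
    rw [← ofReal_measureReal]
    refine ENNReal.ofReal_le_ofReal ?_
    rw [le_div_iff₀ hW0]
    linarith
  have hN : μ {ω | ¬ Function.Injective ω} = 0 := by
    refine ae_iff.1 (ae_injective_pi _ fun k x => ?_)
    rcases k with k | k
    · exact measure_singleton_of_continuousProjections hd hP x
    · exact measure_singleton_of_continuousProjections hd hQ x
  have hsub : {s : (Fin m → E d) × (Fin n → E d) | test α (Fin.append s.1 s.2) = 0} ⊆
      {s | Sum.elim s.1 s.2 ∈ ({ω | W / 2 ≤ |T ω - W|} ∪ {ω | W / 16 ≤ R ω}) ∪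
        {ω | ¬ Function.Injective ω}} := by
    intro s hs
    by_contra hcon
    simp only [Set.mem_ofPred_eq, Set.mem_union, not_or, not_le, not_not] at hcon hs
    obtain ⟨⟨h1, h2⟩, h3⟩ := hcon
    have h4 := integral_vStat_le_of_test_eq_zero hd hm hn hα hα' hθ hθ' (append_injective h3) hs
    simp only [Fin.append_left, Fin.append_right] at h4
    have h5 := (weighted_meanSqGap_le_integral_vStat (P : Measure (E d)) Q hd hθ hθ'
      (Sum.elim s.1 s.2)).trans h4
    change 1 / 2 * T (Sum.elim s.1 s.2) - 2 * R (Sum.elim s.1 s.2) ≤ 4 / α * r at h5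
    have h6 : 8 * (4 / α * r) ≤ W := by
      refine le_trans (le_of_eq ?_) hsep
      ring
    -- Off the bad events `T/2 > W/4` and `2R < W/8`, so the lower bound exceeds `W/8`, while `h6`
    -- says `4r / α ≤ W/8`.
    linarith [(abs_lt.1 h1).1]
  calc typeIIError α m n P Q
      ≤ μ (({ω | W / 2 ≤ |T ω - W|} ∪ {ω | W / 16 ≤ R ω}) ∪ {ω | ¬ Function.Injective ω}) := by
        rw [hμ, ← sampleLaw_preimage]
        exact measure_mono hsub
    _ ≤ μ {ω | W / 2 ≤ |T ω - W|} + μ {ω | W / 16 ≤ R ω} + μ {ω | ¬ Function.Injective ω} :=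
        (measure_union_le _ _).trans (add_le_add (measure_union_le _ _) le_rfl)
    _ ≤ ENNReal.ofReal (4 * r / W) + ENNReal.ofReal (48 * r / W) := by
        rw [hN, add_zero]
        exact add_le_add hA hB
    _ = ENNReal.ofReal (52 * r / W) := by
        rw [← ENNReal.ofReal_add (by positivity) (by positivity)]
        congr 1
        ring

end CvM

end

theorem mainTheorem3 (α : ℝ) (hα : 0 < α ∧ α < 1) (ζ : ℝ) (hζ : 0 < ζ ∧ ζ < 1 - α) :
    ∃ c₀ : ℝ, 0 < c₀ ∧ ∀ c : ℝ, c₀ ≤ c →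
      ∀ (d m n : ℕ), 1 ≤ d → 2 ≤ m → 2 ≤ n → ∀ θ : ℝ, 0 < θ → θ < 1 →
        (⨆ p ∈ CvM.altClass d θ (c * (1 / Real.sqrt m + 1 / Real.sqrt n)),
          CvM.typeIIError α m n p.1 p.2) < ENNReal.ofReal ζ := by
  obtain ⟨hα0, hα1⟩ := hα
  obtain ⟨hζ0, hζ1⟩ := hζ
  -- The first summand supplies the separation required by `typeIIError_le`; the second makes the
  -- bound `52r / W` at most `ζ/2`, leaving room for a strict inequality after the supremum. As `c ≥
  -- 1`, the factor `c²` may be replaced by `c`.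
  refine ⟨32 / α + 104 / ζ, by positivity, fun c hc d m n hd hm hn θ hθ hθ' => ?_⟩
  have h1 : 32 ≤ 32 / α := by
    rw [le_div_iff₀ hα0]
    linarith
  have hζpos : 0 < 104 / ζ := by positivity
  have hc1 : 1 ≤ c := by linarith
  have hcc : c ≤ c ^ 2 := by nlinarith
  have hm0 : (0 : ℝ) < m := by exact_mod_cast (by omega : 0 < m)
  have hn0 : (0 : ℝ) < n := by exact_mod_cast (by omega : 0 < n)
  have hr : (0 : ℝ) < 1 / m + 1 / n := by positivity
  refine lt_of_le_of_lt (b := ENNReal.ofReal (ζ / 2)) (iSup₂_le fun p hp => ?_)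
    ((ENNReal.ofReal_lt_ofReal_iff hζ0).2 (by linarith))
  obtain ⟨hP, hQ, hε⟩ := hp
  have hε0 : 0 < c * (1 / Real.sqrt m + 1 / Real.sqrt n) := by
    have := Real.sqrt_pos.2 hm0
    have := Real.sqrt_pos.2 hn0
    positivity
  have hW : c ^ 2 * (1 / m + 1 / n) ≤ CvM.sqDist θ (p.1 : MeasureTheory.Measure (CvM.E d)) p.2 := by
    have h2 := (Real.le_sqrt' hε0).1 hε
    refine le_trans ?_ h2
    rw [mul_pow]
    refine mul_le_mul_of_nonneg_left ?_ (sq_nonneg c)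
    have e1 : (1 / Real.sqrt m) ^ 2 = 1 / m := by rw [div_pow, one_pow, Real.sq_sqrt hm0.le]
    have e2 : (1 / Real.sqrt n) ^ 2 = 1 / n := by rw [div_pow, one_pow, Real.sq_sqrt hn0.le]
    -- Dropping the cross term of the square leaves `(1/√m + 1/√n)² ≥ 1/m + 1/n`.
    have e3 : 0 ≤ 1 / Real.sqrt m * (1 / Real.sqrt n) := by positivity
    rw [← e1, ← e2]
    nlinarith
  have hW0 : 0 < CvM.sqDist θ (p.1 : MeasureTheory.Measure (CvM.E d)) p.2 :=
    lt_of_lt_of_le (by positivity) hW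
  refine (CvM.typeIIError_le hd hm hn hα0 hα1 hθ.le hθ'.le p.1 p.2 hP hQ rfl hW0 ?_).trans
    (ENNReal.ofReal_le_ofReal ?_)
  · exact (mul_le_mul_of_nonneg_right (by linarith) hr.le).trans hW
  · rw [div_le_iff₀ hW0]
    have h3 : 104 / ζ * (1 / m + 1 / n) ≤
        CvM.sqDist θ (p.1 : MeasureTheory.Measure (CvM.E d)) p.2 :=
      (mul_le_mul_of_nonneg_right (by linarith) hr.le).trans hW
    calc 52 * (1 / (m : ℝ) + 1 / n) = ζ / 2 * (104 / ζ * (1 / m + 1 / n)) := by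
          field_simp
          norm_num
      _ ≤ _ := mul_le_mul_of_nonneg_left h3 (by positivity)
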